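/- A DeMorgan circuit on the variables $x_1,\dots,x_n$ is a directed acyclic graph whose nodes are the variables, binary AND gates, binary OR gates, NOT gates and the constants $0,1$, with arbitrary fan-out and a designated output node; its size is the number of its binary (AND and OR) gates. It is normalized if no simplification applies to it: no gate reads a constant; no NOT gate reads a NOT gate; no binary gate reads two literals of the same node (that is, no binary gate has inputs $\gamma,\gamma$, or $\gamma,\neg\gamma$, or $\neg\gamma,\neg\gamma$); and no NOT gate or constant is left over unused, i.e. each of them is read by some gate or is the output. Let $\mathrm{XOR}_n(x)=x_1\oplus\cdots\oplus x_n$. **Lemma.** There are a deterministic (multi-stack, equivalently multi-tape) Turing machine $M$ and a polynomial $p$ such that for every $n\ge 1$ and every normalized DeMorgan circuit $C$ on $n$ variables of size exactly $3(n-1)$, the machine $M$, given a description of $C$ (the list of its gates in a topological order, with indices in unary), halts after at most $p(n)$ steps and correctly outputs which of the following holds: (1) $C$ computes $\mathrm{XOR}_n$; (2) $C$ computes $\neg\mathrm{XOR}_n$; (3) neither. -/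

import Mathlib

namespace XorDetect

/-- A place from which a bit can be read: an input variable, or the output of the `j`-th gate. -/
inductive Wire (n : ℕ) where
  | input (i : Fin n)
  | gate (j : ℕ)
  deriving DecidableEq

/-- Gates of DeMorgan circuits. Constants are allowed as gates without inputs. -/
inductive Gate (n : ℕ) where
  | const (b : Bool)
  | neg (a : Wire n)
  | conj (a b : Wire n)
  | disj (a b : Wire n)
  deriving DecidableEq

/-- The list of wires read by a gate. -/
def Gate.reads {n : ℕ} : Gate n → List (Wire n)
  | .const _ => []
  | .neg a => [a]
  | .conj a b => [a, b]
  | .disj a b => [a, b]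

/-- Binary gates are the gates that count towards the size of a circuit. -/
def Gate.isBinary {n : ℕ} : Gate n → Bool
  | .const _ => false
  | .neg _ => false
  | .conj _ _ => true
  | .disj _ _ => true

/-- `w.Before k`: the wire `w` is an input variable or one of the gates `0, …, k - 1`. -/
def Wire.Before {n : ℕ} (k : ℕ) : Wire n → Prop
  | .input _ => True
  | .gate j => j < k

/-- A DeMorgan circuit with unbounded fan-out on the variables `x₀, …, xₙ₋₁`: a directed acyclic
graph of gates, given in a topological order, with a designated output wire. -/
structure Circuit (n : ℕ) where
  gates : List (Gate n)
  output : Wire n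
  acyclic : ∀ (k : ℕ) (g : Gate n), gates[k]? = some g → ∀ w ∈ g.reads, w.Before k
  output_valid : output.Before gates.length

/-- The bit on a wire, given the input `x` and the values of the gates computed so far. -/
def Wire.eval {n : ℕ} (x : Fin n → Bool) (vals : List Bool) : Wire n → Bool
  | .input i => x i
  | .gate j => vals.getD j false

/-- The bit computed by a gate. -/
def Gate.eval {n : ℕ} (x : Fin n → Bool) (vals : List Bool) : Gate n → Bool
  | .const b => b
  | .neg a => !(a.eval x vals)
  | .conj a b => a.eval x vals && b.eval x vals
  | .disj a b => a.eval x vals || b.eval x vals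

/-- The values of a list of gates, computed one after the other. -/
def evalGates {n : ℕ} (x : Fin n → Bool) (gs : List (Gate n)) : List Bool :=
  gs.foldl (fun vals g => vals ++ [g.eval x vals]) []

namespace Circuit

variable {n : ℕ}

/-- The Boolean function computed by a circuit. -/
def eval (C : Circuit n) (x : Fin n → Bool) : Bool :=
  C.output.eval x (evalGates x C.gates)

/-- The size of a circuit is its number of binary gates. -/
def size (C : Circuit n) : ℕ := C.gates.countP Gate.isBinary

/-- The wire of which `w` is the negation, if `w` is a negation gate; otherwise `w` itself. -/
def base (C : Circuit n) : Wire n → Wire n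
  | .input i => .input i
  | .gate j =>
    match C.gates[j]? with
    | some (.neg a) => a
    | _ => .gate j

/-- A circuit is normalized if no simplification rule applies to it. -/
structure Normalized (C : Circuit n) : Prop where
  /-- Fixing and passing rules do not apply: no gate reads a constant. -/
  no_const_read : ∀ g ∈ C.gates, ∀ j, Wire.gate j ∈ g.reads →
    ∀ b, C.gates[j]? ≠ some (.const b)
  /-- There are no double negations. -/
  no_double_neg : ∀ j, Gate.neg (.gate j) ∈ C.gates → ∀ a, C.gates[j]? ≠ some (.neg a)
  /-- No conjunction has the form `γ ∧ γ`, `γ ∧ ¬γ`, `¬γ ∧ γ` or `¬γ ∧ ¬γ`. -/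
  conj_distinct : ∀ a b, Gate.conj a b ∈ C.gates → C.base a ≠ C.base b
  /-- No disjunction has the form `γ ∨ γ`, `γ ∨ ¬γ`, `¬γ ∨ γ` or `¬γ ∨ ¬γ`. -/
  disj_distinct : ∀ a b, Gate.disj a b ∈ C.gates → C.base a ≠ C.base b
  /-- The gates that are not counted by the size (negations and constants) are not left over:
  each of them is read by a gate or is the output. -/
  free_used : ∀ k g, C.gates[k]? = some g → g.isBinary = false →
    C.output = .gate k ∨ ∃ h ∈ C.gates, Wire.gate k ∈ h.reads

end Circuit

/-- The parity of `n` bits: their sum modulo 2. -/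
def xorFn (n : ℕ) (x : Fin n → Bool) : Bool :=
  decide ((∑ i, (x i).toNat) % 2 = 1)

/-- The three possible answers. -/
inductive Verdict where
  | isXor
  | isNegXor
  | neither
  deriving DecidableEq

open Classical in
/-- The right answer for a circuit. -/
noncomputable def Circuit.verdict {n : ℕ} (C : Circuit n) : Verdict :=
  if ∀ x, C.eval x = xorFn n x then .isXor
  else if ∀ x, C.eval x = !(xorFn n x) then .isNegXor
  else .neither

/-- The alphabet in which circuits are written down. -/
inductive Sym where
  | tick
  | input
  | gate
  | const (b : Bool)
  | neg
  | conj
  | disj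
  | output
  deriving DecidableEq

/-- An input variable or a gate is written as a tag followed by its index in unary. -/
def Wire.encode {n : ℕ} : Wire n → List Sym
  | .input i => Sym.input :: List.replicate i Sym.tick
  | .gate j => Sym.gate :: List.replicate j Sym.tick

/-- A gate is written as its type followed by the wires that it reads. -/
def Gate.encode {n : ℕ} : Gate n → List Sym
  | .const b => [Sym.const b]
  | .neg a => Sym.neg :: a.encode
  | .conj a b => Sym.conj :: (a.encode ++ b.encode)
  | .disj a b => Sym.disj :: (a.encode ++ b.encode)

/-- A circuit is written as the number of variables in unary, followed by the gates in order and
by the output wire. -/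
def Circuit.encode {n : ℕ} (C : Circuit n) : List Sym :=
  List.replicate n Sym.tick ++ C.gates.flatMap Gate.encode ++ Sym.output :: C.output.encode

/-- On the input word `u`, the (multi-stack) Turing machine `M` halts after at most `t` steps, with
the word `v` as its output. -/
def HaltsWithin {Γ₀ Γ₁ : Type} (M : Turing.TM2ComputableAux Γ₀ Γ₁) (u : List Γ₀) (v : List Γ₁)
    (t : ℕ) : Prop :=
  Nonempty (Turing.TM2OutputsInTime M.tm (u.map M.inputAlphabet.symm)
    (some (v.map M.outputAlphabet.symm)) t)

end XorDetect

/-! Over the field with two elements parity has degree 1, and the key fact is that in a circuit of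
size `3 * (n - 1)` for parity or its negation every gate has degree at most 2
(`card_eq_and_degLT_of_chain`). The proof is by gate elimination. Only binary gates are kept, and a
gate is redundant if it is constant or equals, up to negation, a variable or an earlier gate. Take a
chain that cannot be shortened. Fixing a variable makes at most three gates redundant, since
otherwise the rest would beat the lower bound for one variable fewer. Let `A` be the first gate and
`x`, `y` the variables it reads. The bound forces a block of three gates (`Tight.exists_block`): `x`
and `y` are read by `A` and a second gate `B` only, both conjunctions of literals of `x` and `y`,
and `A` and `B` are read only by a gate `D` that computes x ⊕ y up to negation. All other gates see
`x` and `y` through x ⊕ y. Setting `x` to 0 deletes the block and leaves a chain of minimal size,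
whose members have degree at most 2 by induction; substituting x ⊕ y for `y` is linear and preserves
this.

Low degree can be verified locally. If the operands of a gate have degree at most 2, the gate has
degree at most 4, so only its coefficients of degree 3 and 4 have to vanish. These are iterated
derivatives at 0 in unit directions, hence visible on the subcubes through 0 spanned by at most four
unit vectors (`DegLT.of_subcubes`). Tests of all gates on these subcubes certify degree at most 2,
gate by gate in topological order. An output of degree at most 2 is then determined by its values on
the same subcubes. Thus the tests are sound and complete (`Circuit.verdict_eq`).

The machine runs through the `(n + 1) ^ 4` choices of four directions, zero allowed. On each subcube
a wire is a truth table with 16 entries, which fits into one stack symbol. Normalization bounds the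
number of all gates linearly in `n`, so a round takes O(n²) steps and the whole computation O(n⁶).
-/

namespace XorDetect

/-! ### Degree over the field with two elements, by discrete derivatives. -/

section Degree

variable {ι κ : Type*}

/-- Pointwise addition modulo 2. -/
def xorVec (u a : ι → Bool) : ι → Bool := fun i => u i ^^ a i

/-- The vector with a single `true`. -/
def unitVec [DecidableEq ι] (i : ι) : ι → Bool := fun j => decide (j = i)

/-- The discrete derivative of a Boolean function in the direction `a`. -/
def diff (a : ι → Bool) (f : (ι → Bool) → Bool) : (ι → Bool) → Bool :=
  fun u => f (xorVec u a) ^^ f u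

/-- `DegLT k f`: as a polynomial over the field with two elements, `f` has degree less than `k`;
that is, all `k`-fold derivatives of `f` vanish. -/
def DegLT : ℕ → ((ι → Bool) → Bool) → Prop
  | 0, f => ∀ u, f u = false
  | k + 1, f => ∀ a, DegLT k (diff a f)

theorem xorVec_comm (u a : ι → Bool) : xorVec u a = xorVec a u := by
  funext i; simp [xorVec, Bool.xor_comm]

theorem xorVec_assoc (u a b : ι → Bool) :
    xorVec (xorVec u a) b = xorVec u (xorVec a b) := by
  funext i; simp [xorVec]

theorem xorVec_right_comm (u a b : ι → Bool) :
    xorVec (xorVec u a) b = xorVec (xorVec u b) a := by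
  rw [xorVec_assoc, xorVec_comm a b, ← xorVec_assoc]

@[simp] theorem xorVec_false (u : ι → Bool) : xorVec u (fun _ => false) = u := by
  funext i; simp [xorVec]

namespace DegLT

theorem succ : ∀ {k : ℕ} {f : (ι → Bool) → Bool}, DegLT k f → DegLT (k + 1) f
  | 0, f, h => fun a u => by simp [diff, h _]
  | _ + 1, _, h => fun a => succ (h a)

theorem mono {k l : ℕ} (hkl : k ≤ l) {f : (ι → Bool) → Bool} (h : DegLT k f) : DegLT l f := by
  induction l, hkl using Nat.le_induction with
  | base => exact h
  | succ l _ ih => exact ih.succ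

theorem xor : ∀ {k : ℕ} {f g : (ι → Bool) → Bool}, DegLT k f → DegLT k g →
    DegLT k (fun u => f u ^^ g u)
  | 0, f, g, hf, hg => fun u => by simp [hf u, hg u]
  | k + 1, f, g, hf, hg => fun a => by
    have : diff a (fun u => f u ^^ g u) = fun u => diff a f u ^^ diff a g u := by
      funext u; simp only [diff]; simp only [Bool.xor_assoc, Bool.xor_left_comm]
    rw [this]
    exact xor (hf a) (hg a)

/-- Differentiating `f ∘ L` in direction `a` amounts to differentiating `f` in direction `L a` and
then composing with `L`. This serves both linear changes of variables and restrictions to subcubes.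
-/
theorem comp_additive {L : (κ → Bool) → (ι → Bool)}
    (hL : ∀ u a, L (xorVec u a) = xorVec (L u) (L a)) :
    ∀ {k : ℕ} {f : (ι → Bool) → Bool}, DegLT k f → DegLT k (fun u => f (L u))
  | 0, f, hf => fun u => hf (L u)
  | k + 1, f, hf => fun a => by
    have : diff a (fun u => f (L u)) = fun u => diff (L a) f (L u) := by
      funext u; simp only [diff, hL]
    rw [this]
    exact comp_additive hL (hf (L a))

theorem shift (b : ι → Bool) : ∀ {k : ℕ} {f : (ι → Bool) → Bool}, DegLT k f →
    DegLT k (fun u => f (xorVec u b))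
  | 0, f, hf => fun u => hf _
  | k + 1, f, hf => fun a => by
    have : diff a (fun u => f (xorVec u b)) = fun u => diff a f (xorVec u b) := by
      funext u; simp only [diff, xorVec_right_comm u a b]
    rw [this]
    exact shift b (hf a)

theorem zero (k : ℕ) : DegLT k (fun _ : ι → Bool => false) :=
  mono (Nat.zero_le k) (show DegLT 0 _ from fun _ => rfl)

/-- Product rule: the derivative of `f g` in direction `a` is `f` times the derivative of `g`, plus
the derivative of `f` times the translate of `g`. The bound says that degrees add, since `DegLT p`
means degree at most `p - 1`. -/
theorem and {p q : ℕ} {f g : (ι → Bool) → Bool} (hf : DegLT p f) (hg : DegLT q g) :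
    DegLT (p + q - 1) (fun u => f u && g u) := by
  induction p generalizing q f g with
  | zero =>
    have : (fun u => f u && g u) = fun _ => false := by funext u; simp [hf u]
    rw [this]; exact zero _
  | succ p ihp =>
    induction q generalizing f g with
    | zero =>
      have : (fun u => f u && g u) = fun _ => false := by funext u; simp [hg u]
      rw [this]; exact zero _
    | succ q ihq =>
      rw [show p + 1 + (q + 1) - 1 = p + q + 1 by omega]
      intro a
      have : diff a (fun u => f u && g u) =
          fun u => (f u && diff a g u) ^^ (diff a f u && g (xorVec u a)) := by
        funext u
        simp only [diff]
        generalize f (xorVec u a) = x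
        generalize f u = y
        generalize g (xorVec u a) = z
        generalize g u = w
        revert x y z w
        decide
      rw [this]
      refine xor ?_ ?_
      · have := ihq hf (hg a)
        rwa [show p + 1 + q - 1 = p + q by omega] at this
      · have := ihp (hf a) (hg.shift a)
        rwa [show p + (q + 1) - 1 = p + q by omega] at this

theorem const (b : Bool) : DegLT 1 (fun _ : ι → Bool => b) := fun a u => by simp [diff]

theorem not {k : ℕ} (hk : 1 ≤ k) {f : (ι → Bool) → Bool} (hf : DegLT k f) :
    DegLT k (fun u => !f u) := by
  have := hf.xor ((const true).mono hk)
  simpa using this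

theorem coord (i : ι) : DegLT 2 (fun u : ι → Bool => u i) := fun a b u => by
  simp only [diff, xorVec]
  generalize u i = x
  generalize a i = y
  generalize b i = z
  revert x y z
  decide

theorem of_apply_zero {f : (ι → Bool) → Bool} (hf : DegLT 1 f) (h0 : f (fun _ => false) = false) :
    DegLT 0 f := fun u => by
  have := hf u (fun _ => false)
  rw [diff, h0, xorVec_comm] at this
  simpa using this

/-- With D for the derivative, D_{a+b} f(u) = D_a f(u+b) + D_b f(u). So a derivative in any
direction is a sum of translates of derivatives in unit directions; the induction is on a set
containing the support of the direction. -/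
theorem of_units [Fintype ι] [DecidableEq ι] {k : ℕ} {f : (ι → Bool) → Bool}
    (h : ∀ i, DegLT k (diff (unitVec i) f)) : DegLT (k + 1) f := by
  have key : ∀ (s : Finset ι) (a : ι → Bool), (∀ i, i ∉ s → a i = false) →
      DegLT k (diff a f) := by
    intro s
    induction s using Finset.induction_on with
    | empty =>
      intro a ha
      have : diff a f = fun _ => false := by
        have : a = fun _ => false := funext fun i => ha i (by simp)
        subst this
        funext u; simp [diff]
      rw [this]; exact zero _
    | insert i s hi ih =>
      intro a ha
      by_cases hai : a i = true
      · have hb : DegLT k (diff (Function.update a i false) f) := by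
          refine ih _ fun j hj => ?_
          by_cases hji : j = i
          · subst hji; simp
          · rw [Function.update_of_ne hji]; exact ha j (by simp [hji, hj])
        have hsum : a = xorVec (Function.update a i false) (unitVec i) := by
          funext j
          by_cases hji : j = i
          · subst hji; simp [xorVec, unitVec, hai]
          · simp [xorVec, unitVec, hji]
        have : diff a f = fun u => diff (Function.update a i false) f (xorVec u (unitVec i)) ^^
            diff (unitVec i) f u := by
          funext u
          conv_lhs => rw [hsum]
          simp only [diff, xorVec_assoc, xorVec_comm (unitVec i)]
          simp
        rw [this]
        exact (hb.shift _).xor (h i)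
      · refine ih a fun j hj => ?_
        by_cases hji : j = i
        · subst hji; simpa using hai
        · exact ha j (by simp [hji, hj])
  exact fun a => key Finset.univ a (by simp)

/-- A function of degree at most 4 has degree at most 2 if its coefficients of degree 3 and 4
vanish. -/
theorem of_diff_zero [Fintype ι] [DecidableEq ι] {f : (ι → Bool) → Bool} (hf : DegLT 5 f)
    (h3 : ∀ i j k, diff (unitVec i) (diff (unitVec j) (diff (unitVec k) f)) (fun _ => false) = false)
    (h4 : ∀ i j k l, diff (unitVec i) (diff (unitVec j) (diff (unitVec k) (diff (unitVec l) f)))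
      (fun _ => false) = false) : DegLT 3 f := by
  -- Fourth derivatives of `f` are constant, so `h4` makes those in unit directions vanish. Hence
  -- the third derivatives are constant, and `h3` finishes.
  refine of_units fun k => of_units fun j => of_units fun i => of_apply_zero ?_ (h3 i j k)
  exact of_units fun l => of_apply_zero (hf _ _ _ _) (h4 l i j k)

/-- A function of degree at most 2 vanishes if its coefficients vanish. -/
theorem eq_false_of_diff_zero [Fintype ι] [DecidableEq ι] {f : (ι → Bool) → Bool} (hf : DegLT 3 f)
    (h0 : f (fun _ => false) = false)
    (h1 : ∀ i, diff (unitVec i) f (fun _ => false) = false)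
    (h2 : ∀ i j, diff (unitVec i) (diff (unitVec j) f) (fun _ => false) = false) :
    ∀ u, f u = false := by
  refine of_apply_zero (of_units fun j => of_apply_zero (of_units fun i => ?_) (h1 j)) h0
  exact of_apply_zero (hf _ _) (h2 i j)

end DegLT

end Degree

end XorDetect

namespace XorDetect

/-! ### Chains of conjunctions up to negation, redundant gates, restrictions. -/

section Chain

variable {ι : Type*}

/-- The function `p` can be read off, up to negation, from the variables in `S` and from the
functions `v j` with `j ∈ G`. -/
def Avail (S : Finset ι) (G : Finset ℕ) (v : ℕ → (ι → Bool) → Bool) (p : (ι → Bool) → Bool) :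
    Prop :=
  (∃ c, ∀ u, p u = c) ∨ (∃ i ∈ S, ∃ s, ∀ u, p u = (s ^^ u i)) ∨
    ∃ j ∈ G, ∃ s, ∀ u, p u = (s ^^ v j u)

/-- Each of the functions `v k` with `k ∈ G` is, up to negation, the conjunction of two functions
that are available from the variables in `S` and the preceding functions. -/
def Chain (S : Finset ι) (G : Finset ℕ) (v : ℕ → (ι → Bool) → Bool) : Prop :=
  ∀ k ∈ G, ∃ p q o, Avail S (G.filter (· < k)) v p ∧ Avail S (G.filter (· < k)) v q ∧
    ∀ u, v k u = (o ^^ (p u && q u))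

/-- The function `f` changes its value whenever one of the variables in `S` does. -/
def Sensitive [DecidableEq ι] (S : Finset ι) (f : (ι → Bool) → Bool) : Prop :=
  ∀ u, ∀ i ∈ S, f (Function.update u i (!u i)) = !f u

/-- The restriction of a function to the inputs with `x = c`. -/
def restr [DecidableEq ι] (x : ι) (c : Bool) (p : (ι → Bool) → Bool) : (ι → Bool) → Bool :=
  fun u => p (Function.update u x c)

section Avail

variable {S : Finset ι} {G G' : Finset ℕ} {v : ℕ → (ι → Bool) → Bool} {p : (ι → Bool) → Bool}

theorem Avail.mono (hG : G ⊆ G') (h : Avail S G v p) : Avail S G' v p := by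
  rcases h with h | h | ⟨j, hj, h⟩
  · exact .inl h
  · exact .inr (.inl h)
  · exact .inr (.inr ⟨j, hG hj, h⟩)

theorem Avail.xor (h : Avail S G v p) (b : Bool) {q : (ι → Bool) → Bool}
    (hq : ∀ u, q u = (b ^^ p u)) : Avail S G v q := by
  rcases h with ⟨c, h⟩ | ⟨i, hi, s, h⟩ | ⟨j, hj, s, h⟩
  · exact .inl ⟨b ^^ c, fun u => by rw [hq, h]⟩
  · exact .inr (.inl ⟨i, hi, b ^^ s, fun u => by rw [hq, h, Bool.xor_assoc]⟩)
  · exact .inr (.inr ⟨j, hj, b ^^ s, fun u => by rw [hq, h, Bool.xor_assoc]⟩)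

/-- What replaces a deleted gate may itself be a deleted gate, but always an earlier one, so the
replacements terminate. -/
theorem Avail.filter_sdiff {E : Finset ℕ}
    (hE : ∀ k ∈ E, k ∈ G → Avail S (G.filter (· < k)) v (v k)) (k : ℕ) :
    ∀ {p : (ι → Bool) → Bool}, Avail S (G.filter (· < k)) v p →
      Avail S ((G \ E).filter (· < k)) v p := by
  induction k using Nat.strong_induction_on with
  | _ k ih =>
    rintro p (h | h | ⟨j, hj, s, h⟩)
    · exact .inl h
    · exact .inr (.inl h)
    · rw [Finset.mem_filter] at hj
      by_cases hjE : j ∈ E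
      · refine ((ih j hj.2 (hE j hjE hj.1)).mono ?_).xor s h
        intro i hi
        simp only [Finset.mem_filter] at hi ⊢
        exact ⟨hi.1, hi.2.trans hj.2⟩
      · exact .inr (.inr ⟨j, by simp [hj, hjE], s, h⟩)

theorem Avail.sdiff {E : Finset ℕ} (hE : ∀ k ∈ E, k ∈ G → Avail S (G.filter (· < k)) v (v k))
    (h : Avail S G v p) : Avail S (G \ E) v p := by
  have hG : G.filter (· < G.sup id + 1) = G :=
    Finset.filter_true_of_mem fun k hk => Nat.lt_succ_of_le (Finset.le_sup (f := id) hk)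
  rw [← hG] at h
  exact (h.filter_sdiff hE).mono (Finset.filter_subset _ _)

theorem Chain.sdiff {E : Finset ℕ} (hE : ∀ k ∈ E, k ∈ G → Avail S (G.filter (· < k)) v (v k))
    (h : Chain S G v) : Chain S (G \ E) v := by
  intro k hk
  obtain ⟨p, q, o, hp, hq, hk⟩ := h k (Finset.mem_sdiff.1 hk).1
  exact ⟨p, q, o, hp.filter_sdiff hE, hq.filter_sdiff hE, hk⟩

variable [DecidableEq ι]

theorem Avail.restr (x : ι) (c : Bool) (h : Avail S G v p) :
    Avail (S.erase x) G (fun k => restr x c (v k)) (restr x c p) := by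
  rcases h with ⟨b, h⟩ | ⟨i, hi, s, h⟩ | ⟨j, hj, s, h⟩
  · exact .inl ⟨b, fun u => h _⟩
  · by_cases hix : i = x
    · subst hix
      exact .inl ⟨s ^^ c, fun u => by simp [XorDetect.restr, h]⟩
    · exact .inr (.inl ⟨i, by simp [hi, hix], s, fun u => by simp [XorDetect.restr, h, hix]⟩)
  · exact .inr (.inr ⟨j, hj, s, fun u => by simp [XorDetect.restr, h]⟩)

theorem Chain.restr (x : ι) (c : Bool) (h : Chain S G v) :
    Chain (S.erase x) G (fun k => restr x c (v k)) := by
  intro k hk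
  obtain ⟨p, q, o, hp, hq, hk⟩ := h k hk
  exact ⟨_, _, o, hp.restr x c, hq.restr x c, fun u => hk _⟩

theorem Sensitive.restr {f : (ι → Bool) → Bool} (h : Sensitive S f) (x : ι) (c : Bool) :
    Sensitive (S.erase x) (restr x c f) := by
  intro u i hi
  rw [Finset.mem_erase] at hi
  have := h (Function.update u x c) i hi.2
  rwa [Function.update_of_ne hi.1, Function.update_comm (Ne.symm hi.1)] at this

end Avail

/-- The function computed at a node: a variable or a gate. -/
def nodeVal (v : ℕ → (ι → Bool) → Bool) : ι ⊕ ℕ → (ι → Bool) → Bool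
  | .inl i => fun u => u i
  | .inr j => v j

/-- A node that may be read by the gate `k`. -/
def NodeValid (S : Finset ι) (G : Finset ℕ) (k : ℕ) : ι ⊕ ℕ → Prop
  | .inl i => i ∈ S
  | .inr j => j ∈ G ∧ j < k

/-- Two nodes read by a gate, and the positions of the negations. -/
structure Operands (ι : Type*) where
  left : ι ⊕ ℕ
  right : ι ⊕ ℕ
  negLeft : Bool
  negRight : Bool
  negOut : Bool

/-- `g` describes the gate `k`. -/
def Operands.Describes (S : Finset ι) (G : Finset ℕ) (v : ℕ → (ι → Bool) → Bool) (k : ℕ)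
    (g : Operands ι) : Prop :=
  NodeValid S G k g.left ∧ NodeValid S G k g.right ∧
    ∀ u, v k u = (g.negOut ^^ ((g.negLeft ^^ nodeVal v g.left u) &&
      (g.negRight ^^ nodeVal v g.right u)))

/-- The gate described by `g` reads the node `m`. -/
abbrev Operands.Reads (g : Operands ι) (m : ι ⊕ ℕ) : Prop := g.left = m ∨ g.right = m

/-- Up to negations, `p` is the conjunction of `x` and `y`. -/
def IsAnd (x y : ι) (p : (ι → Bool) → Bool) : Prop :=
  ∃ o a b, ∀ u : ι → Bool, p u = (o ^^ ((a ^^ u x) && (b ^^ u y)))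

theorem IsAnd.symm {x y : ι} {p : (ι → Bool) → Bool} (h : IsAnd x y p) : IsAnd y x p := by
  obtain ⟨o, a, b, h⟩ := h
  exact ⟨o, b, a, fun u => by rw [h, Bool.and_comm]⟩

/-- A conjunction with a constant operand is constant or equals its other operand up to negation;
either way the gate is redundant. -/
theorem Chain.exists_operands {S : Finset ι} {G : Finset ℕ} {v : ℕ → (ι → Bool) → Bool}
    (h : Chain S G v) {k : ℕ} (hk : k ∈ G) (hred : ¬ Avail S (G.filter (· < k)) v (v k)) :
    ∃ g : Operands ι, g.Describes S G v k := by
  obtain ⟨p, q, o, hp, hq, hv⟩ := h k hk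
  have node : ∀ {p}, Avail S (G.filter (· < k)) v p → (∃ c, ∀ u, p u = c) ∨
      ∃ m s, NodeValid S G k m ∧ ∀ u, p u = (s ^^ nodeVal v m u) := by
    rintro p (h | ⟨i, hi, s, h⟩ | ⟨j, hj, s, h⟩)
    · exact .inl h
    · exact .inr ⟨.inl i, s, hi, h⟩
    · exact .inr ⟨.inr j, s, Finset.mem_filter.1 hj, h⟩
  rcases node hp with ⟨c, hc⟩ | ⟨m, s, hm, hs⟩
  · refine absurd ?_ hred
    cases c
    · exact .inl ⟨o, fun u => by simp [hv, hc]⟩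
    · exact hq.xor o fun u => by simp [hv, hc]
  rcases node hq with ⟨c, hc⟩ | ⟨m', s', hm', hs'⟩
  · refine absurd ?_ hred
    cases c
    · exact .inl ⟨o, fun u => by simp [hv, hc]⟩
    · exact hp.xor o fun u => by simp [hv, hc]
  exact ⟨⟨m, m', s, s', o⟩, hm, hm', fun u => by rw [hv, hs, hs']⟩

theorem Operands.Describes.of_reads {S : Finset ι} {G : Finset ℕ} {v : ℕ → (ι → Bool) → Bool}
    {k : ℕ} {g : Operands ι} (h : g.Describes S G v k) {m : ι ⊕ ℕ} (hm : g.Reads m) :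
    ∃ m' o s t, NodeValid S G k m ∧ NodeValid S G k m' ∧ g.Reads m' ∧
      (∀ m'', g.Reads m'' → m'' = m ∨ m'' = m') ∧
      ∀ u, v k u = (o ^^ ((s ^^ nodeVal v m u) && (t ^^ nodeVal v m' u))) := by
  obtain ⟨hl, hr, hv⟩ := h
  rcases hm with rfl | rfl
  · exact ⟨g.right, _, _, _, hl, hr, .inr rfl,
      fun m'' h => h.imp (fun h => h.symm) (fun h => h.symm), hv⟩
  · refine ⟨g.left, g.negOut, g.negRight, g.negLeft, hr, hl, .inl rfl,
      fun m'' h => h.symm.imp (fun h => h.symm) (fun h => h.symm), fun u => ?_⟩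
    rw [hv, Bool.and_comm]

theorem Operands.Describes.of_reads_of_ne {S : Finset ι} {G : Finset ℕ}
    {v : ℕ → (ι → Bool) → Bool} {k : ℕ} {g : Operands ι} (h : g.Describes S G v k)
    {m m' : ι ⊕ ℕ} (hm : g.Reads m) (hm' : g.Reads m') (hne : m ≠ m') :
    ∃ o s t, ∀ u, v k u = (o ^^ ((s ^^ nodeVal v m u) && (t ^^ nodeVal v m' u))) := by
  obtain ⟨m'', o, s, t, -, -, -, hall, hv⟩ := h.of_reads hm
  obtain h | rfl := hall m' hm'
  · exact absurd h.symm hne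
  · exact ⟨o, s, t, hv⟩

/-- A conjunction of two literals of the same bit. -/
theorem and_self_cases : ∀ o s t : Bool,
    (∃ c, ∀ w, (o ^^ ((s ^^ w) && (t ^^ w))) = c) ∨
    (∃ c, ∀ w, (o ^^ ((s ^^ w) && (t ^^ w))) = (c ^^ w)) := by
  decide

/-- A conjunction of literals of `A` and `x`, where `A` is a conjunction of literals of `x` and
`y`. -/
theorem and_and_cases : ∀ o a b o' s t : Bool,
    (∃ c, ∀ x y, (o' ^^ ((s ^^ (o ^^ ((a ^^ x) && (b ^^ y)))) && (t ^^ x))) = c) ∨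
    (∃ c, ∀ x y, (o' ^^ ((s ^^ (o ^^ ((a ^^ x) && (b ^^ y)))) && (t ^^ x))) = (c ^^ x)) ∨
    (∃ c, ∀ x y, (o' ^^ ((s ^^ (o ^^ ((a ^^ x) && (b ^^ y)))) && (t ^^ x))) =
      (c ^^ (o ^^ ((a ^^ x) && (b ^^ y))))) ∨
    (∃ c d e, ∀ x y, (o' ^^ ((s ^^ (o ^^ ((a ^^ x) && (b ^^ y)))) && (t ^^ x))) =
      (c ^^ ((d ^^ x) && (e ^^ y)))) := by
  decide

/-- A conjunction of two conjunctions of literals of `x` and `y`. -/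
theorem and_and_and_cases : ∀ a b a' b' s t : Bool,
    (∃ c, ∀ x y, ((s ^^ ((a ^^ x) && (b ^^ y))) && (t ^^ ((a' ^^ x) && (b' ^^ y)))) = c) ∨
    (∃ c, ∀ x y, ((s ^^ ((a ^^ x) && (b ^^ y))) && (t ^^ ((a' ^^ x) && (b' ^^ y)))) =
      (c ^^ x)) ∨
    (∃ c, ∀ x y, ((s ^^ ((a ^^ x) && (b ^^ y))) && (t ^^ ((a' ^^ x) && (b' ^^ y)))) =
      (c ^^ y)) ∨
    (∃ c d e, ∀ x y, ((s ^^ ((a ^^ x) && (b ^^ y))) && (t ^^ ((a' ^^ x) && (b' ^^ y)))) =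
      (c ^^ ((d ^^ x) && (e ^^ y)))) ∨
    (∃ c, ∀ x y, ((s ^^ ((a ^^ x) && (b ^^ y))) && (t ^^ ((a' ^^ x) && (b' ^^ y)))) =
      (c ^^ (x ^^ y))) := by
  decide

end Chain

end XorDetect

namespace XorDetect

/-! ### The block of three gates at the start of a tight chain. -/

section Tight

variable {ι : Type*}

/-- `X` holds for the gates that are allowed to change between the two inputs; the change is
contained if no gate outside `X` passes it on. -/
theorem agree_of_forall {G : Finset ℕ} {v : ℕ → (ι → Bool) → Bool} {u w : ι → Bool}
    (X : ℕ → Prop)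
    (h : ∀ k ∈ G, ¬ X k → (∀ j ∈ G, j < k → ¬ X j → v j u = v j w) → v k u = v k w) (k : ℕ) :
    k ∈ G → ¬ X k → v k u = v k w := by
  induction k using Nat.strong_induction_on with
  | _ k ih => exact fun hk hX => h k hk hX fun j hj hjk hjX => ih j hjk hj hjX

theorem Operands.Describes.congr {S : Finset ι} {G : Finset ℕ} {v : ℕ → (ι → Bool) → Bool}
    {k : ℕ} {g : Operands ι} (h : g.Describes S G v k) {u w : ι → Bool}
    (hm : ∀ m, NodeValid S G k m → g.Reads m → nodeVal v m u = nodeVal v m w) :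
    v k u = v k w := by
  rw [h.2.2, h.2.2, hm _ h.1 (.inl rfl), hm _ h.2.1 (.inr rfl)]

/-- A conjunction of literals of `x` and `y` becomes constant when `y` takes a suitable value. -/
theorem IsAnd.exists_kill {x y : ι} {p : (ι → Bool) → Bool} (h : IsAnd x y p) :
    ∃ c o, ∀ u, u y = c → p u = o := by
  obtain ⟨o, a, b, h⟩ := h
  exact ⟨b, o, fun u hu => by simp [h, hu]⟩

variable [DecidableEq ι]

/-- The gates that read the node `m`. -/
def readers (G : Finset ℕ) (d : ℕ → Operands ι) (m : ι ⊕ ℕ) : Finset ℕ :=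
  G.filter fun k => (d k).Reads m

theorem mem_readers {G : Finset ℕ} {d : ℕ → Operands ι} {m : ι ⊕ ℕ} {k : ℕ} :
    k ∈ readers G d m ↔ k ∈ G ∧ (d k).Reads m := Finset.mem_filter

/-- A chain for a sensitive function `v out`, without redundant gates, in which no restriction of a
variable makes more than three gates redundant. The gates that are conjunctions of literals of `x`
and `y` read `x` and `y`. -/
structure Tight (S : Finset ι) (G : Finset ℕ) (v : ℕ → (ι → Bool) → Bool) (d : ℕ → Operands ι)
    (x y : ι) (out : ℕ) : Prop where
  left_mem : x ∈ S
  right_mem : y ∈ S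
  ne : x ≠ y
  describes : ∀ k ∈ G, (d k).Describes S G v k
  not_avail : ∀ k ∈ G, ¬ Avail S (G.filter (· < k)) v (v k)
  out_mem : out ∈ G
  sensitive : Sensitive S (v out)
  reads_of_isAnd : ∀ k ∈ G, IsAnd x y (v k) → ∀ m, (d k).Reads m ↔ m = .inl x ∨ m = .inl y
  used : ∀ k ∈ G, k ≠ out → (readers G d (.inr k)).Nonempty
  card_le : ∀ z ∈ S, ∀ c, ∀ E ⊆ G,
    (∀ k ∈ E, Avail (S.erase z) (G.filter (· < k)) (fun k => restr z c (v k)) (restr z c (v k))) →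
    E.card ≤ 3

/-- The literals and the gates before `k` remain available after a restriction. -/
theorem NodeValid.avail_restr {S : Finset ι} {G : Finset ℕ} {v : ℕ → (ι → Bool) → Bool}
    {k : ℕ} {m : ι ⊕ ℕ} (h : NodeValid S G k m) (z : ι) (c : Bool) :
    Avail (S.erase z) (G.filter (· < k)) (fun k => restr z c (v k))
      (restr z c (nodeVal v m)) := by
  refine Avail.restr z c ?_
  cases m with
  | inl i => exact .inr (.inl ⟨i, h, false, fun u => by simp [nodeVal]⟩)
  | inr j => exact .inr (.inr ⟨j, Finset.mem_filter.2 h, false, fun u => by simp [nodeVal]⟩)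

/-- A gate becomes redundant when one of its operands becomes constant. -/
theorem Operands.Describes.avail_restr {S : Finset ι} {G : Finset ℕ}
    {v : ℕ → (ι → Bool) → Bool} {k : ℕ} {g : Operands ι} (h : g.Describes S G v k) {z : ι}
    {c : Bool} {m : ι ⊕ ℕ} (hm : g.Reads m) {b : Bool}
    (hb : ∀ u, restr z c (nodeVal v m) u = b) :
    Avail (S.erase z) (G.filter (· < k)) (fun k => restr z c (v k)) (restr z c (v k)) := by
  obtain ⟨m', o, s, t, -, hm', -, -, hv⟩ := h.of_reads hm
  have hv' : ∀ u, restr z c (v k) u = (o ^^ ((s ^^ b) && (t ^^ restr z c (nodeVal v m') u))) := by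
    intro u
    rw [← hb u]
    exact hv _
  by_cases hsb : (s ^^ b) = true
  · refine (hm'.avail_restr z c).xor (o ^^ t) fun u => ?_
    rw [hv', hsb, Bool.true_and, Bool.xor_assoc]
  · refine .inl ⟨o, fun u => ?_⟩
    rw [Bool.not_eq_true] at hsb
    rw [hv', hsb]
    simp

theorem Operands.Describes.avail_restr_of_reads {S : Finset ι} {G : Finset ℕ}
    {v : ℕ → (ι → Bool) → Bool} {k : ℕ} {g : Operands ι} (h : g.Describes S G v k) {z : ι}
    (hz : g.Reads (.inl z)) (c : Bool) :
    Avail (S.erase z) (G.filter (· < k)) (fun k => restr z c (v k)) (restr z c (v k)) :=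
  h.avail_restr hz (b := c) fun u => by simp [restr, nodeVal]

namespace Tight

variable {S : Finset ι} {G : Finset ℕ} {v : ℕ → (ι → Bool) → Bool} {d : ℕ → Operands ι}
  {x y : ι} {out : ℕ}

theorem symm (h : Tight S G v d x y out) : Tight S G v d y x out where
  left_mem := h.right_mem
  right_mem := h.left_mem
  ne := h.ne.symm
  describes := h.describes
  not_avail := h.not_avail
  out_mem := h.out_mem
  sensitive := h.sensitive
  reads_of_isAnd k hk hand m := by rw [h.reads_of_isAnd k hk hand.symm m, or_comm]
  used := h.used
  card_le := h.card_le

/-- A flip of a variable has to be noticed by one of the gates that read it. -/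
theorem flip_false (h : Tight S G v d x y out) {z : ι} (hz : z ∈ S) (u : ι → Bool) (X : ℕ → Prop)
    (hX : ¬ X out)
    (hyp : ∀ k ∈ G, ¬ X k → ((d k).Reads (.inl z) ∨ ∃ j, X j ∧ (d k).Reads (.inr j)) →
      (∀ j ∈ G, j < k → ¬ X j → v j u = v j (Function.update u z (!u z))) →
      v k u = v k (Function.update u z (!u z))) : False := by
  have := agree_of_forall (G := G) (v := v) (u := u) (w := Function.update u z (!u z)) X ?_ out
    h.out_mem hX
  · rw [h.sensitive u z hz] at this
    simp at this
  · intro k hk hkX hprev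
    by_cases hr : (d k).Reads (.inl z) ∨ ∃ j, X j ∧ (d k).Reads (.inr j)
    · exact hyp k hk hkX hr hprev
    · rw [not_or] at hr
      refine (h.describes k hk).congr fun m hm hread => ?_
      cases m with
      | inl i =>
        have : i ≠ z := fun hi => hr.1 (hi ▸ hread)
        simp [nodeVal, this]
      | inr j => exact hprev j hm.1 hm.2 fun hj => hr.2 ⟨j, hj, hread⟩

/-- A suitable value of `y` makes the conjunction constant, so it ignores a flip of `x` there,
whereas `v out` notices every flip. -/
theorem ne_out (h : Tight S G v d x y out) {k : ℕ} (hand : IsAnd x y (v k)) : k ≠ out := by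
  rintro rfl
  obtain ⟨c, o, hkill⟩ := hand.exists_kill
  have := h.sensitive (fun _ => c) x h.left_mem
  rw [hkill _ (by simp [h.ne.symm]), hkill _ rfl] at this
  simp at this

/-- No gate reads both `x` and a conjunction of literals of `x` and `y`. -/
theorem not_reads (h : Tight S G v d x y out) {A : ℕ} (hand : IsAnd x y (v A)) {k : ℕ}
    (hk : k ∈ G) (hkA : (d k).Reads (.inr A)) : ¬ (d k).Reads (.inl x) := by
  intro hkx
  have hA : A ∈ G ∧ A < k := by
    obtain ⟨_, _, _, _, hA, -⟩ := (h.describes k hk).of_reads hkA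
    exact hA
  obtain ⟨o', s, t, hv⟩ := (h.describes k hk).of_reads_of_ne hkA hkx (by simp)
  obtain ⟨o, a, b, hAv⟩ := hand
  have hv : ∀ u, v k u = (o' ^^ ((s ^^ (o ^^ ((a ^^ u x) && (b ^^ u y)))) && (t ^^ u x))) := by
    intro u
    rw [hv u]
    simp only [nodeVal, hAv]
  have hred := h.not_avail k hk
  -- In three cases the gate is constant or a literal of `x` or `A`, hence redundant. In the last
  -- one it is itself a conjunction of literals of `x` and `y`; such gates read only these two
  -- variables, not `A`.
  rcases and_and_cases o a b o' s t with ⟨c, hc⟩ | ⟨c, hc⟩ | ⟨c, hc⟩ | ⟨c, e, e', hc⟩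
  · exact hred (.inl ⟨c, fun u => by rw [hv, hc]⟩)
  · exact hred (.inr (.inl ⟨x, h.left_mem, c, fun u => by rw [hv, hc]⟩))
  · exact hred (.inr (.inr ⟨A, Finset.mem_filter.2 hA, c, fun u => by rw [hv, hc, hAv]⟩))
  · have := (h.reads_of_isAnd k hk ⟨c, e, e', fun u => by rw [hv, hc]⟩ (.inr A)).1 hkA
    simp at this

/-- The counting step: `x` is read by two gates and each conjunction of literals of `x` and `y` is
read by one. -/
theorem card_readers (h : Tight S G v d x y out) {A : ℕ} (hA : A ∈ G) (hand : IsAnd x y (v A)) :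
    (readers G d (.inl x)).card = 2 ∧ (readers G d (.inr A)).card = 1 := by
  have hAx : A ∈ readers G d (.inl x) :=
    mem_readers.2 ⟨hA, (h.reads_of_isAnd A hA hand _).2 (.inl rfl)⟩
  have hone : 1 ≤ (readers G d (.inr A)).card :=
    Finset.card_pos.2 (h.used A hA (h.ne_out hand))
  -- If only `A` read `x`, then with `y` set to make `A` constant no gate would notice a flip of
  -- `x`.
  have htwo : 2 ≤ (readers G d (.inl x)).card := by
    by_contra hlt
    have hA' : readers G d (.inl x) = {A} := by
      refine (Finset.eq_of_subset_of_card_le (Finset.singleton_subset_iff.2 hAx) ?_).symm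
      rw [Finset.card_singleton]
      omega
    obtain ⟨c, o, hkill⟩ := hand.exists_kill
    refine h.flip_false h.left_mem (fun _ => c) (fun _ => False) id fun k hk _ hr _ => ?_
    have : k ∈ readers G d (.inl x) := mem_readers.2 ⟨hk, by simpa using hr⟩
    rw [hA', Finset.mem_singleton] at this
    subst this
    rw [hkill _ rfl, hkill _ (by simp [h.ne.symm])]
  have hdisj : Disjoint (readers G d (.inl x)) (readers G d (.inr A)) := by
    rw [Finset.disjoint_left]
    intro k hkx hkA
    rw [mem_readers] at hkx hkA
    exact h.not_reads hand hkx.1 hkA.2 hkx.2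
  -- Give `x` the value that makes `A` constant: then all readers of `x` and of `A` are redundant,
  -- so there are at most three of them.
  have hle : (readers G d (.inl x) ∪ readers G d (.inr A)).card ≤ 3 := by
    obtain ⟨c, o, hkill⟩ := hand.symm.exists_kill
    refine h.card_le x h.left_mem c _ ?_ fun k hk => ?_
    · exact Finset.union_subset (Finset.filter_subset _ _) (Finset.filter_subset _ _)
    rw [Finset.mem_union, mem_readers, mem_readers] at hk
    rcases hk with ⟨hk, hr⟩ | ⟨hk, hr⟩
    · exact (h.describes k hk).avail_restr_of_reads hr c
    · exact (h.describes k hk).avail_restr hr (b := o) fun u => hkill _ (by simp)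
  rw [Finset.card_union_of_disjoint hdisj] at hle
  omega

/-- The second gate that reads `x` also reads `y`. -/
theorem reads_right (h : Tight S G v d x y out) {A B : ℕ} (hA : A ∈ G) (hand : IsAnd x y (v A))
    (hB : B ∈ G) (hBA : B ≠ A) (hBx : (d B).Reads (.inl x)) : (d B).Reads (.inl y) := by
  by_contra hBy
  have hAr := h.reads_of_isAnd A hA hand
  have hRx : readers G d (.inl x) = {A, B} := by
    refine (Finset.eq_of_subset_of_card_le ?_ ?_).symm
    · intro k hk
      rw [Finset.mem_insert, Finset.mem_singleton] at hk
      rcases hk with rfl | rfl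
      · exact mem_readers.2 ⟨hA, (hAr _).2 (.inl rfl)⟩
      · exact mem_readers.2 ⟨hB, hBx⟩
    · rw [(h.card_readers hA hand).1, Finset.card_pair hBA.symm]
  obtain ⟨B', hB', hB'A⟩ := Finset.exists_mem_ne
    (show 1 < (readers G d (.inl y)).card by rw [(h.symm.card_readers hA hand.symm).1]; simp) A
  obtain ⟨D, hD⟩ := h.used A hA (h.ne_out hand)
  rw [mem_readers] at hB' hD
  obtain ⟨c, o, hkill⟩ := hand.exists_kill
  obtain ⟨m, o', s, t, -, hm, hmB, -, hv⟩ := (h.describes B hB).of_reads hBx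
  have hmx : m ≠ .inl x := by
    rintro rfl
    refine h.not_avail B hB ?_
    rcases and_self_cases o' s t with ⟨c, hc⟩ | ⟨c, hc⟩
    · exact .inl ⟨c, fun u => by rw [hv, hc]⟩
    · exact .inr (.inl ⟨x, h.left_mem, c, fun u => by rw [hv, hc]; rfl⟩)
  -- With `y = c` the gate `A` is constant, so `B` alone can notice a flip of `x`. Its other operand
  -- does not change under the flip and must therefore let `x` pass.
  have htrue : ∀ u : ι → Bool, u y = c → (t ^^ nodeVal v m u) = true := by
    intro u hu
    by_contra hfalse
    rw [Bool.not_eq_true] at hfalse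
    refine h.flip_false h.left_mem u (fun _ => False) id fun k hk _ hr hprev => ?_
    have hkx : k ∈ readers G d (.inl x) := mem_readers.2 ⟨hk, by simpa using hr⟩
    rw [hRx, Finset.mem_insert, Finset.mem_singleton] at hkx
    rcases hkx with rfl | rfl
    · rw [hkill _ hu, hkill _ (by simp [h.ne.symm, hu])]
    · have : nodeVal v m (Function.update u x (!u x)) = nodeVal v m u := by
        cases m with
        | inl i =>
          have : i ≠ x := fun hi => hmx (hi ▸ rfl)
          simp [nodeVal, this]
        | inr j => exact (hprev j hm.1 hm.2 id).symm
      rw [hv, hv, this, hfalse]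
      simp
  -- Setting `y = c` makes four different gates redundant: `A` and `B'` read `y`, `D` reads the now
  -- constant `A`, and `B` becomes a literal of `x`.
  have hle := h.card_le y h.right_mem c {A, B, B', D} ?_ ?_
  · have h1 : A ≠ D := by
      rintro rfl
      have := (hAr _).1 hD.2
      simp at this
    have h2 : B ≠ D := by
      rintro rfl
      exact h.not_reads hand hD.1 hD.2 hBx
    have h3 : B ≠ B' := by
      rintro rfl
      exact hBy hB'.2
    have h4 : B' ≠ D := by
      rintro rfl
      exact h.symm.not_reads hand.symm hD.1 hD.2 hB'.2
    rw [Finset.card_insert_of_notMem (by simp [hBA.symm, hB'A.symm, h1]),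
      Finset.card_insert_of_notMem (by simp [h2, h3]), Finset.card_pair h4] at hle
    omega
  · intro k hk
    simp only [Finset.mem_insert, Finset.mem_singleton] at hk
    rcases hk with rfl | rfl | rfl | rfl
    exacts [hA, hB, hB'.1, hD.1]
  · intro k hk
    simp only [Finset.mem_insert, Finset.mem_singleton] at hk
    rcases hk with rfl | rfl | rfl | rfl
    · exact (h.describes k hA).avail_restr_of_reads ((hAr _).2 (.inr rfl)) c
    · refine .inr (.inl ⟨x, Finset.mem_erase.2 ⟨h.ne, h.left_mem⟩, o' ^^ s, fun u => ?_⟩)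
      have := htrue (Function.update u y c) (by simp)
      simp only [restr]
      rw [hv, this]
      simp [nodeVal, h.ne]
    · exact (h.describes k hB'.1).avail_restr_of_reads hB'.2 c
    · exact (h.describes k hD.1).avail_restr hD.2 (b := o) fun u => hkill _ (by simp)

/-- The readers of `A` and of `B` cannot be different. -/
theorem not_lt_of_readers (h : Tight S G v d x y out) {A B D D' : ℕ} (hA : A ∈ G)
    (hAand : IsAnd x y (v A)) (hBand : IsAnd x y (v B))
    (hRx : ∀ k ∈ G, (d k).Reads (.inl x) → k = A ∨ k = B)
    (hRy : ∀ k ∈ G, (d k).Reads (.inl y) → k = A ∨ k = B)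
    (hRA : ∀ k ∈ G, (d k).Reads (.inr A) → k = D) (hRB : ∀ k ∈ G, (d k).Reads (.inr B) → k = D')
    (hD : D ∈ G) (hDA : (d D).Reads (.inr A)) : ¬ D < D' := by
  intro hlt
  obtain ⟨m, o, s, t, hAn, hm, hmD, -, hv⟩ := (h.describes D hD).of_reads hDA
  have hmA : m ≠ .inr A := by
    rintro rfl
    refine h.not_avail D hD ?_
    rcases and_self_cases o s t with ⟨c, hc⟩ | ⟨c, hc⟩
    · exact .inl ⟨c, fun u => by rw [hv, hc]⟩
    · exact .inr (.inr ⟨A, Finset.mem_filter.2 hAn, c, fun u => by rw [hv, hc]; rfl⟩)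
  have hmB : m ≠ .inr B := by
    rintro rfl
    exact hlt.ne (hRB D hD hmD)
  have hmx : m ≠ .inl x := by
    rintro rfl
    exact h.not_reads hAand hD hDA hmD
  have hmy : m ≠ .inl y := by
    rintro rfl
    exact h.symm.not_reads hAand.symm hD hDA hmD
  -- Otherwise `D` would equal `A` up to negation.
  have hex : ∃ u, (t ^^ nodeVal v m u) = false := by
    by_contra hall
    simp only [not_exists, Bool.not_eq_false] at hall
    refine h.not_avail D hD (.inr (.inr ⟨A, Finset.mem_filter.2 hAn, o ^^ s, fun u => ?_⟩))
    rw [hv, hall u]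
    simp [nodeVal]
  obtain ⟨u₀, hu₀⟩ := hex
  obtain ⟨c, e, hkill⟩ := hBand.exists_kill
  -- Only `D` reads `A`, and only `D' > D` reads `B`; so neither `x` nor `y` has a path to the other
  -- operand of `D`.
  have indep : ∀ u w : ι → Bool, (∀ i, i ≠ x → i ≠ y → u i = w i) →
      nodeVal v m u = nodeVal v m w := by
    intro u w huw
    have hgate := agree_of_forall (G := G.filter (· < D)) (v := v) (u := u) (w := w)
      (fun k => k = A ∨ k = B) fun k hk hkX hprev => by
        rw [Finset.mem_filter] at hk
        refine (h.describes k hk.1).congr fun m' hm' hread => ?_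
        cases m' with
        | inl i =>
          refine huw i ?_ ?_
          · rintro rfl
            exact hkX (hRx k hk.1 hread)
          · rintro rfl
            exact hkX (hRy k hk.1 hread)
        | inr j =>
          refine hprev j (Finset.mem_filter.2 ⟨hm'.1, hm'.2.trans hk.2⟩) hm'.2 ?_
          rintro (rfl | rfl)
          · exact hk.2.ne (hRA k hk.1 hread)
          · exact (hk.2.trans hlt).ne (hRB k hk.1 hread)
    cases m with
    | inl i => exact huw i (fun hi => hmx (hi ▸ rfl)) (fun hi => hmy (hi ▸ rfl))
    | inr j =>
      refine hgate j (Finset.mem_filter.2 hm) ?_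
      rintro (rfl | rfl)
      · exact hmA rfl
      · exact hmB rfl
  have hu : ∀ w : ι → Bool, (∀ i, i ≠ x → i ≠ y → w i = u₀ i) →
      (t ^^ nodeVal v m w) = false := by
    intro w hw
    rw [indep w u₀ hw, hu₀]
  -- Here `y = c` makes `B` constant, and `u₀` makes the other operand of `D` block `A`. A flip of
  -- `x` can then change `A` only and never reaches `out`.
  refine h.flip_false h.left_mem (Function.update u₀ y c) (· = A) (h.ne_out hAand).symm
    fun k hk hkA hr _ => ?_
  rcases hr with hr | ⟨j, rfl, hr⟩
  · obtain rfl := (hRx k hk hr).resolve_left hkA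
    rw [hkill _ (by simp), hkill _ (by simp [h.ne.symm])]
  · obtain rfl := hRA k hk hr
    rw [hv, hv, hu _ fun i _ hiy => by simp [hiy], hu _ fun i hix hiy => by simp [hix, hiy]]
    simp

/-- The chain starts with a block of three gates that computes the parity of `x` and `y`. -/
theorem exists_block (h : Tight S G v d x y out) {A : ℕ} (hA : A ∈ G) (hand : IsAnd x y (v A)) :
    ∃ B D, A ∈ G ∧ B ∈ G ∧ D ∈ G ∧ A ≠ B ∧ A ≠ D ∧ B ≠ D ∧ IsAnd x y (v B) ∧
      (d A).Reads (.inl x) ∧ (d B).Reads (.inl x) ∧ (∃ c, ∀ u, v D u = (c ^^ (u x ^^ u y))) ∧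
      ∀ u w : ι → Bool, (∀ i, i ≠ x → i ≠ y → u i = w i) → (u x ^^ u y) = (w x ^^ w y) →
        ∀ k ∈ G, k ≠ A → k ≠ B → v k u = v k w := by
  have hAr := h.reads_of_isAnd A hA hand
  obtain ⟨B, hB, hBA⟩ := Finset.exists_mem_ne
    (show 1 < (readers G d (.inl x)).card by rw [(h.card_readers hA hand).1]; simp) A
  rw [mem_readers] at hB
  have hBy := h.reads_right hA hand hB.1 hBA hB.2
  have hBand : IsAnd x y (v B) := by
    obtain ⟨o, s, t, hv⟩ := (h.describes B hB.1).of_reads_of_ne hB.2 hBy (by simp [h.ne])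
    exact ⟨o, s, t, hv⟩
  have hBr := h.reads_of_isAnd B hB.1 hBand
  have pair : ∀ z, z = x ∨ z = y → (readers G d (.inl z)).card = 2 →
      ∀ k ∈ G, (d k).Reads (.inl z) → k = A ∨ k = B := by
    intro z hz hcard k hk hr
    have : readers G d (.inl z) = {A, B} := by
      refine (Finset.eq_of_subset_of_card_le ?_ ?_).symm
      · intro k hk
        rw [Finset.mem_insert, Finset.mem_singleton] at hk
        rcases hk with rfl | rfl
        · exact mem_readers.2 ⟨hA, (hAr _).2 (by simpa using hz)⟩
        · exact mem_readers.2 ⟨hB.1, (hBr _).2 (by simpa using hz)⟩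
      · rw [hcard, Finset.card_pair hBA.symm]
    have hk' : k ∈ readers G d (.inl z) := mem_readers.2 ⟨hk, hr⟩
    simpa [this] using hk'
  have hRx := pair x (.inl rfl) (h.card_readers hA hand).1
  have hRy := pair y (.inr rfl) (h.symm.card_readers hA hand.symm).1
  have single : ∀ C ∈ G, IsAnd x y (v C) → ∃ D, D ∈ G ∧ (d D).Reads (.inr C) ∧
      ∀ k ∈ G, (d k).Reads (.inr C) → k = D := by
    intro C hC hCand
    obtain ⟨D, hD⟩ := Finset.card_eq_one.1 (h.card_readers hC hCand).2
    have hD' : D ∈ readers G d (.inr C) := by simp [hD]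
    refine ⟨D, (mem_readers.1 hD').1, (mem_readers.1 hD').2, fun k hk hr => ?_⟩
    have : k ∈ readers G d (.inr C) := mem_readers.2 ⟨hk, hr⟩
    simpa [hD] using this
  obtain ⟨D, hD, hDA, hRA⟩ := single A hA hand
  obtain ⟨D', hD', hDB, hRB⟩ := single B hB.1 hBand
  obtain rfl : D = D' := by
    refine le_antisymm (not_lt.1 ?_) (not_lt.1 ?_)
    · exact h.not_lt_of_readers hB.1 hBand hand (fun k hk hr => (hRx k hk hr).symm)
        (fun k hk hr => (hRy k hk hr).symm) hRB hRA hD' hDB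
    · exact h.not_lt_of_readers hA hand hBand hRx hRy hRA hRB hD hDA
  have hDx := h.not_reads hand hD hDA
  have hAD : A ≠ D := by
    rintro rfl
    exact hDx ((hAr _).2 (.inl rfl))
  have hBD : B ≠ D := by
    rintro rfl
    exact hDx ((hBr _).2 (.inl rfl))
  have hDxor : ∃ c, ∀ u, v D u = (c ^^ (u x ^^ u y)) := by
    obtain ⟨o₁, a, b, hAv⟩ := hand
    obtain ⟨o₂, a', b', hBv⟩ := hBand
    obtain ⟨o, s, t, hv⟩ := (h.describes D hD).of_reads_of_ne hDA hDB (by simp [hBA.symm])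
    have hv : ∀ u, v D u = (o ^^ (((s ^^ o₁) ^^ ((a ^^ u x) && (b ^^ u y))) &&
        ((t ^^ o₂) ^^ ((a' ^^ u x) && (b' ^^ u y))))) := by
      intro u
      rw [hv u]
      simp only [nodeVal, hAv, hBv, Bool.xor_assoc]
    have hred := h.not_avail D hD
    -- The first three cases make `D` redundant; in the fourth it would be a conjunction of literals
    -- of `x` and `y` and so read `x`. Parity remains.
    rcases and_and_and_cases a b a' b' (s ^^ o₁) (t ^^ o₂) with
      ⟨c, hc⟩ | ⟨c, hc⟩ | ⟨c, hc⟩ | ⟨c, e, e', hc⟩ | ⟨c, hc⟩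
    · exact absurd (.inl ⟨o ^^ c, fun u => by rw [hv, hc]⟩) hred
    · exact absurd (.inr (.inl ⟨x, h.left_mem, o ^^ c, fun u => by
        rw [hv, hc, Bool.xor_assoc]⟩)) hred
    · exact absurd (.inr (.inl ⟨y, h.right_mem, o ^^ c, fun u => by
        rw [hv, hc, Bool.xor_assoc]⟩)) hred
    · have hDand : IsAnd x y (v D) := ⟨o ^^ c, e, e', fun u => by rw [hv, hc, Bool.xor_assoc]⟩
      exact absurd ((h.reads_of_isAnd D hD hDand _).2 (.inl rfl)) hDx
    · exact ⟨o ^^ c, fun u => by rw [hv, hc, Bool.xor_assoc]⟩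
  refine ⟨B, D, hA, hB.1, hD, hBA.symm, hAD, hBD, hBand, (hAr _).2 (.inl rfl), hB.2, hDxor, ?_⟩
  intro u w huw hxor k hk hkA hkB
  refine agree_of_forall (G := G) (v := v) (u := u) (w := w) (fun k => k = A ∨ k = B)
    (fun k hk hkX hprev => ?_) k hk (by simp [hkA, hkB])
  -- A change in `A` and `B` can leave the block only through `D`, whose value depends on x ⊕ y
  -- alone.
  by_cases hkD : k = D
  · subst hkD
    obtain ⟨c, hc⟩ := hDxor
    rw [hc, hc, hxor]
  refine (h.describes k hk).congr fun m hm hread => ?_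
  cases m with
  | inl i =>
    refine huw i ?_ ?_
    · rintro rfl
      exact hkX (hRx k hk hread)
    · rintro rfl
      exact hkX (hRy k hk hread)
  | inr j =>
    refine hprev j hm.1 hm.2 ?_
    rintro (rfl | rfl)
    · exact hkD (hRA k hk hread)
    · exact hkD (hRB k hk hread)

end Tight

end Tight

end XorDetect

namespace XorDetect

/-! ### Lower bound for sensitive functions, and the degree of the gates of minimal chains. -/

section ChainDegree

variable {ι : Type*}

theorem IsAnd.degLT {x y : ι} {p : (ι → Bool) → Bool} (h : IsAnd x y p) : DegLT 3 p := by
  obtain ⟨o, a, b, h⟩ := h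
  have lit : ∀ (s : Bool) (i : ι), DegLT 2 (fun u : ι → Bool => s ^^ u i) := fun s i =>
    ((DegLT.const s).mono (by omega)).xor (DegLT.coord i)
  have := ((DegLT.const o).mono (show 1 ≤ 3 by omega)).xor ((lit a x).and (lit b y))
  rwa [show p = _ from funext h]

theorem chain_of_describes {S : Finset ι} {G : Finset ℕ} {v : ℕ → (ι → Bool) → Bool}
    {d : ℕ → Operands ι} (h : ∀ k ∈ G, (d k).Describes S G v k) : Chain S G v := by
  intro k hk
  obtain ⟨hl, hr, hv⟩ := h k hk
  have node : ∀ m s, NodeValid S G k m →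
      Avail S (G.filter (· < k)) v (fun u => s ^^ nodeVal v m u) := by
    rintro (i | j) s hm
    · exact .inr (.inl ⟨i, hm, s, fun u => rfl⟩)
    · exact .inr (.inr ⟨j, Finset.mem_filter.2 hm, s, fun u => rfl⟩)
  exact ⟨_, _, (d k).negOut, node _ (d k).negLeft hl, node _ (d k).negRight hr, hv⟩

variable [DecidableEq ι]

/-- A chain that cannot be shortened and that computes a sensitive function of at least two
variables is tight for suitable operands. -/
theorem exists_tight {S : Finset ι} {G : Finset ℕ} {v : ℕ → (ι → Bool) → Bool}
    {p : (ι → Bool) → Bool} (hS : 2 ≤ S.card) (hchain : Chain S G v) (hp : Avail S G v p)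
    (hsens : Sensitive S p) (hmin : ∀ G' ⊂ G, Chain S G' v → ¬ Avail S G' v p)
    (hcard : ∀ z ∈ S, ∀ c, ∀ E ⊆ G,
      (∀ k ∈ E, Avail (S.erase z) (G.filter (· < k)) (fun k => restr z c (v k))
        (restr z c (v k))) → E.card ≤ 3) :
    ∃ d x y out A, Tight S G v d x y out ∧ A ∈ G ∧ IsAnd x y (v A) := by
  have hred : ∀ k ∈ G, ¬ Avail S (G.filter (· < k)) v (v k) := by
    intro k hk hav
    have hE : ∀ j ∈ ({k} : Finset ℕ), j ∈ G → Avail S (G.filter (· < j)) v (v j) := by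
      intro j hj _
      rw [Finset.mem_singleton] at hj
      subst hj
      exact hav
    refine hmin (G \ {k}) ?_ (hchain.sdiff hE) (hp.sdiff hE)
    exact Finset.sdiff_ssubset (Finset.singleton_subset_iff.2 hk) (Finset.singleton_nonempty k)
  obtain ⟨i₀, hi₀⟩ : S.Nonempty := Finset.card_pos.1 (by omega)
  obtain ⟨out, hout, s, hps⟩ : ∃ j ∈ G, ∃ s, ∀ u, p u = (s ^^ v j u) := by
    rcases hp with ⟨c, hc⟩ | ⟨i, hi, s, hs⟩ | hp
    · have := hsens (fun _ => false) i₀ hi₀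
      simp [hc] at this
    · obtain ⟨j, hj, hji⟩ := Finset.exists_mem_ne (show 1 < S.card by omega) i
      have := hsens (fun _ => false) j hj
      simp [hs, Function.update_of_ne hji.symm] at this
    · exact hp
  have hG : G.Nonempty := ⟨out, hout⟩
  -- The first gate has no earlier gate to read, so both its operands are variables.
  obtain ⟨g, hg⟩ := hchain.exists_operands (G.min'_mem hG) (hred _ (G.min'_mem hG))
  have leaf : ∀ m, NodeValid S G (G.min' hG) m → ∃ i ∈ S, m = .inl i := by
    rintro (i | j) hm
    · exact ⟨i, hm, rfl⟩
    · exact absurd (G.min'_le j hm.1) (not_le.2 hm.2)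
  obtain ⟨hgl, hgr, hgv⟩ := hg
  obtain ⟨x, hx, hgx⟩ := leaf _ hgl
  obtain ⟨y, hy, hgy⟩ := leaf _ hgr
  rw [hgx, hgy] at hgv
  have hand : IsAnd x y (v (G.min' hG)) := ⟨_, _, _, hgv⟩
  have hxy : x ≠ y := by
    rintro rfl
    refine hred _ (G.min'_mem hG) ?_
    rcases and_self_cases g.negOut g.negLeft g.negRight with ⟨c, hc⟩ | ⟨c, hc⟩
    · exact .inl ⟨c, fun u => by rw [hgv]; exact hc _⟩
    · exact .inr (.inl ⟨x, hx, c, fun u => by rw [hgv]; exact hc _⟩)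
  -- The description of a gate may be chosen freely: whatever happens to compute a conjunction of
  -- literals of `x` and `y` is described as reading exactly these variables.
  have hd : ∀ k ∈ G, ∃ g : Operands ι, g.Describes S G v k ∧
      (IsAnd x y (v k) → ∀ m, g.Reads m ↔ m = .inl x ∨ m = .inl y) := by
    intro k hk
    by_cases hkand : IsAnd x y (v k)
    · obtain ⟨o, a, b, hv⟩ := hkand
      exact ⟨⟨.inl x, .inl y, a, b, o⟩, ⟨hx, hy, hv⟩, fun _ m =>
        or_congr eq_comm eq_comm⟩
    · obtain ⟨g, hg⟩ := hchain.exists_operands hk (hred k hk)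
      exact ⟨g, hg, fun h => absurd h hkand⟩
  have : Nonempty (Operands ι) := ⟨g⟩
  choose! d hd hdand using hd
  refine ⟨d, x, y, out, G.min' hG, ⟨hx, hy, hxy, hd, hred, hout, ?_, hdand, ?_, hcard⟩,
    G.min'_mem hG, hand⟩
  · intro u i hi
    have := hsens u i hi
    rw [hps, hps] at this
    revert this
    generalize v out u = a
    generalize v out _ = b
    revert s a b
    clear * -
    intro s
    cases s <;> simp
  · intro k hk hkout
    -- A gate that nobody reads and that is not `out` could be deleted, against minimality.
    by_contra hempty
    rw [Finset.not_nonempty_iff_eq_empty] at hempty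
    have hnot : ∀ j ∈ G, ¬ (d j).Reads (.inr k) := by
      intro j hj hr
      have : j ∈ readers G d (.inr k) := mem_readers.2 ⟨hj, hr⟩
      simp [hempty] at this
    refine hmin (G.erase k) (Finset.erase_ssubset hk) ?_
      (.inr (.inr ⟨out, Finset.mem_erase.2 ⟨hkout.symm, hout⟩, s, hps⟩))
    refine chain_of_describes (d := d) fun j hj => ?_
    have hjG := Finset.mem_of_mem_erase hj
    obtain ⟨hl, hr, hv⟩ := hd j hjG
    have node : ∀ m, (d j).Reads m → NodeValid S G j m → NodeValid S (G.erase k) j m := by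
      rintro (i | l) hread hm
      · exact hm
      · refine ⟨Finset.mem_erase.2 ⟨?_, hm.1⟩, hm.2⟩
        rintro rfl
        exact hnot j hjG hread
    exact ⟨node _ (.inl rfl) hl, node _ (.inr rfl) hr, hv⟩

/-- A chain that computes a sensitive function of `N + 1` variables has at least `3 * N` members,
and if it has no more, all of them have degree at most 2. -/
theorem card_eq_and_degLT_of_chain (N : ℕ) : ∀ {S : Finset ι} {G : Finset ℕ}
    {v : ℕ → (ι → Bool) → Bool} {p : (ι → Bool) → Bool}, S.card = N + 1 → Chain S G v →
    Avail S G v p → Sensitive S p → G.card ≤ 3 * N →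
    G.card = 3 * N ∧ ∀ k ∈ G, DegLT 3 (v k) := by
  induction N with
  | zero =>
    intro S G v p _ _ _ _ hG
    have : G = ∅ := Finset.card_eq_zero.1 (by omega)
    simp [this]
  | succ N ih =>
    intro S G
    induction G using Finset.strongInduction with
    | H G ihG =>
      intro v p hS hchain hp hsens hG
      -- A proper subchain would, by `ihG`, already have `3 * (N + 1)` members, which leaves no room
      -- for more in `G`.
      by_cases hmin : ∃ G' ⊂ G, Chain S G' v ∧ Avail S G' v p
      · obtain ⟨G', hG', hchain', hp'⟩ := hmin
        have hlt := Finset.card_lt_card hG'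
        have := (ihG G' hG' hS hchain' hp' hsens (by omega)).1
        omega
      simp only [not_exists, not_and] at hmin
      -- Deleting three or more redundant gates leaves at most `3 * N`, so the induction hypothesis
      -- applies to the restricted chain and gives equality. In particular four redundant gates are
      -- impossible.
      have hsub : ∀ z ∈ S, ∀ c, ∀ E ⊆ G,
          (∀ k ∈ E, Avail (S.erase z) (G.filter (· < k)) (fun k => restr z c (v k))
            (restr z c (v k))) → 3 ≤ E.card →
          (G \ E).card = 3 * N ∧ ∀ k ∈ G \ E, DegLT 3 (restr z c (v k)) := by
        intro z hz c E hEG hE hcard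
        have hE' : ∀ k ∈ E, k ∈ G → Avail (S.erase z) (G.filter (· < k))
          (fun k => restr z c (v k)) (restr z c (v k)) := fun k hk _ => hE k hk
        refine ih ?_ ((hchain.restr z c).sdiff hE') ((hp.restr z c).sdiff hE') (hsens.restr z c) ?_
        · rw [Finset.card_erase_of_mem hz]; omega
        · rw [Finset.card_sdiff_of_subset hEG]; omega
      obtain ⟨d, x, y, out, A, htight, hA, hand⟩ := exists_tight (by omega) hchain hp hsens hmin
        fun z hz c E hEG hE => by
          by_contra hlt
          have h1 := (hsub z hz c E hEG hE (by omega)).1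
          have h2 := Finset.card_le_card hEG
          rw [Finset.card_sdiff_of_subset hEG] at h1
          omega
      obtain ⟨B, D, -, hB, hD, hAB, hAD, hBD, hBand, hAx, hBx, ⟨c, hDv⟩, hlin⟩ :=
        htight.exists_block hA hand
      have hx := htight.left_mem
      have hxy := htight.ne
      have hEG : {A, B, D} ⊆ G := by
        intro k hk
        simp only [Finset.mem_insert, Finset.mem_singleton] at hk
        rcases hk with rfl | rfl | rfl
        exacts [hA, hB, hD]
      have hEcard : ({A, B, D} : Finset ℕ).card = 3 := by
        rw [Finset.card_insert_of_notMem (by simp [hAB, hAD]), Finset.card_pair hBD]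
      have hE : ∀ k ∈ ({A, B, D} : Finset ℕ), Avail (S.erase x) (G.filter (· < k))
          (fun k => restr x false (v k)) (restr x false (v k)) := by
        intro k hk
        simp only [Finset.mem_insert, Finset.mem_singleton] at hk
        rcases hk with rfl | rfl | rfl
        · exact (htight.describes k hA).avail_restr_of_reads hAx false
        · exact (htight.describes k hB).avail_restr_of_reads hBx false
        · refine .inr (.inl ⟨y, Finset.mem_erase.2 ⟨hxy.symm, htight.right_mem⟩, c, fun u => ?_⟩)
          simp [restr, hDv, hxy.symm]
      obtain ⟨hcard, hdeg⟩ := hsub x hx false {A, B, D} hEG hE hEcard.ge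
      rw [Finset.card_sdiff_of_subset hEG, hEcard] at hcard
      have hle := Finset.card_le_card hEG
      refine ⟨by omega, fun k hk => ?_⟩
      by_cases hkA : k = A
      · exact hkA ▸ hand.degLT
      by_cases hkB : k = B
      · exact hkB ▸ hBand.degLT
      by_cases hkD : k = D
      · subst hkD
        rw [show v k = _ from funext hDv]
        exact ((DegLT.const c).mono (by omega)).xor
          (((DegLT.coord x).xor (DegLT.coord y)).mono (by omega))
      have hk' := hdeg k (by simp [hk, hkA, hkB, hkD])
      -- Outside the block a gate equals its restriction to `x = false` composed with the additive
      -- map that replaces `y` by x ⊕ y.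
      have hL : ∀ u a : ι → Bool,
          Function.update (xorVec u a) y (xorVec u a x ^^ xorVec u a y) =
          xorVec (Function.update u y (u x ^^ u y)) (Function.update a y (a x ^^ a y)) := by
        intro u a
        funext i
        by_cases hi : i = y
        · subst hi
          simp [xorVec, Bool.xor_left_comm]
        · simp [xorVec, hi]
      have := hk'.comp_additive (L := fun u => Function.update u y (u x ^^ u y)) hL
      rw [show v k = _ from funext fun u => ?_]
      · exact this
      · refine hlin _ _ (fun i hix hiy => ?_) ?_ k hk hkA hkB
        · simp [hix, hiy]
        · simp [hxy.symm]

end ChainDegree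

end XorDetect

namespace XorDetect

/-! ### Parity is additive. -/

section Parity

variable {n : ℕ}

theorem xorFn_xorVec (u a : Fin n → Bool) :
    xorFn n (xorVec u a) = (xorFn n u ^^ xorFn n a) := by
  have key : ∀ s : Finset (Fin n), decide ((∑ i ∈ s, (xorVec u a i).toNat) % 2 = 1) =
      (decide ((∑ i ∈ s, (u i).toNat) % 2 = 1) ^^ decide ((∑ i ∈ s, (a i).toNat) % 2 = 1)) := by
    have step : ∀ (b : Bool) (m : ℕ), decide ((b.toNat + m) % 2 = 1) =
        (b ^^ decide (m % 2 = 1)) := by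
      rintro (_ | _) m
      · simp
      · rcases Nat.mod_two_eq_zero_or_one m with h | h <;> simp [Nat.add_mod, h]
    intro s
    induction s using Finset.induction_on with
    | empty => simp
    | insert i s hi ih =>
      rw [Finset.sum_insert hi, Finset.sum_insert hi, Finset.sum_insert hi, step, step, step, ih]
      simp only [xorVec, Bool.xor_assoc, Bool.xor_left_comm]
  exact key Finset.univ

theorem xorFn_false : xorFn n (fun _ => false) = false := by simp [xorFn]

theorem xorFn_unitVec (i : Fin n) : xorFn n (unitVec i) = true := by
  have : ∀ j : Fin n, (decide (j = i)).toNat = if j = i then 1 else 0 := fun j => by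
    by_cases h : j = i <;> simp [h]
  simp [xorFn, unitVec, this]

theorem update_not_eq_xorVec {ι : Type*} [DecidableEq ι] (u : ι → Bool) (i : ι) :
    Function.update u i (!u i) = xorVec u (unitVec i) := by
  funext j
  by_cases hj : j = i
  · subst hj; simp [xorVec, unitVec]
  · simp [xorVec, unitVec, hj]

theorem xorFn_degLT : DegLT 2 (xorFn n) := fun a b u => by
  simp only [diff, xorFn_xorVec]
  generalize xorFn n u = x
  generalize xorFn n a = y
  generalize xorFn n b = z
  revert x y z
  decide

end Parity

/-! ### From circuits to chains of binary gates. -/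

section Values

variable {n : ℕ}

/-- The bit computed by a gate, given the bits on all wires. -/
def Gate.evalWith (f : Wire n → Bool) : Gate n → Bool
  | .const b => b
  | .neg a => !f a
  | .conj a b => f a && f b
  | .disj a b => f a || f b

theorem evalGates_append (u : Fin n → Bool) (gs : List (Gate n)) (g : Gate n) :
    evalGates u (gs ++ [g]) = evalGates u gs ++ [g.eval u (evalGates u gs)] := by
  simp [evalGates]

theorem length_evalGates (u : Fin n → Bool) (gs : List (Gate n)) :
    (evalGates u gs).length = gs.length := by
  induction gs using List.reverseRecOn with
  | nil => rfl
  | append_singleton gs g ih => simp [evalGates_append, ih]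

theorem evalGates_prefix (u : Fin n → Bool) (gs hs : List (Gate n)) :
    evalGates u gs <+: evalGates u (gs ++ hs) := by
  induction hs using List.reverseRecOn with
  | nil => simp
  | append_singleton hs h ih =>
    rw [← List.append_assoc, evalGates_append]
    exact ih.trans (List.prefix_append _ _)

/-- The bit on a wire of a circuit. -/
def Circuit.wireVal (C : Circuit n) (w : Wire n) (u : Fin n → Bool) : Bool :=
  w.eval u (evalGates u C.gates)

theorem Wire.eval_take (C : Circuit n) (u : Fin n → Bool) {k : ℕ} (hk : k ≤ C.gates.length)
    {w : Wire n} (hw : w.Before k) :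
    w.eval u (evalGates u (C.gates.take k)) = C.wireVal w u := by
  cases w with
  | input i => rfl
  | gate j =>
    have hj : j < (evalGates u (C.gates.take k)).length := by
      rw [length_evalGates, List.length_take, min_eq_left hk]
      exact hw
    have hpre := evalGates_prefix u (C.gates.take k) (C.gates.drop k)
    rw [List.take_append_drop] at hpre
    simp only [Wire.eval, Circuit.wireVal, List.getD_eq_getElem?_getD]
    obtain ⟨r, hr⟩ := hpre
    rw [← hr, List.getElem?_append_left hj]

theorem Circuit.wireVal_gate (C : Circuit n) (u : Fin n → Bool) {k : ℕ} {g : Gate n}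
    (hg : C.gates[k]? = some g) :
    C.wireVal (.gate k) u = g.evalWith fun w => C.wireVal w u := by
  obtain ⟨hk, rfl⟩ := List.getElem?_eq_some_iff.1 hg
  have hpre := evalGates_prefix u (C.gates.take (k + 1)) (C.gates.drop (k + 1))
  rw [List.take_append_drop, List.take_succ_eq_append_getElem hk, evalGates_append] at hpre
  have hlen : (evalGates u (C.gates.take k)).length = k := by
    rw [length_evalGates, List.length_take, min_eq_left hk.le]
  have hval : C.wireVal (.gate k) u = C.gates[k].eval u (evalGates u (C.gates.take k)) := by
    obtain ⟨r, hr⟩ := hpre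
    simp only [Circuit.wireVal, Wire.eval, ← hr, List.getD_eq_getElem?_getD]
    rw [List.append_assoc, List.getElem?_append_right hlen.le, hlen]
    simp
  have hw := fun w hw => Wire.eval_take C u hk.le (C.acyclic k _ hg w hw)
  rw [hval]
  cases hgk : C.gates[k] with
  | const b => rfl
  | neg a =>
    simp only [Gate.eval, Gate.evalWith]
    rw [hw a (by simp [hgk, Gate.reads])]
  | conj a b =>
    simp only [Gate.eval, Gate.evalWith]
    rw [hw a (by simp [hgk, Gate.reads]), hw b (by simp [hgk, Gate.reads])]
  | disj a b =>
    simp only [Gate.eval, Gate.evalWith]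
    rw [hw a (by simp [hgk, Gate.reads]), hw b (by simp [hgk, Gate.reads])]

theorem Wire.Before.mono {k l : ℕ} (hkl : k ≤ l) {w : Wire n} (h : w.Before k) : w.Before l := by
  cases w with
  | input i => trivial
  | gate j => exact lt_of_lt_of_le (show j < k from h) hkl

/-- The positions of the binary gates. -/
def Circuit.binaries (C : Circuit n) : Finset ℕ :=
  (Finset.range C.gates.length).filter fun k => (C.gates[k]?).any Gate.isBinary = true

theorem Circuit.mem_binaries (C : Circuit n) {k : ℕ} :
    k ∈ C.binaries ↔ ∃ g, C.gates[k]? = some g ∧ g.isBinary = true := by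
  simp only [binaries, Finset.mem_filter, Finset.mem_range, Option.any_eq_true]
  constructor
  · exact fun h => h.2
  · rintro ⟨g, hg, hb⟩
    exact ⟨(List.getElem?_eq_some_iff.1 hg).1, g, hg, hb⟩

theorem Circuit.card_binaries (C : Circuit n) : C.binaries.card = C.size := by
  have key : ∀ l : List (Gate n), ((Finset.range l.length).filter fun k =>
      (l[k]?).any Gate.isBinary = true).card = l.countP Gate.isBinary := by
    intro l
    induction l using List.reverseRecOn with
    | nil => rfl
    | append_singleton l g ih =>
      rw [List.countP_append, ← ih, List.length_append, List.length_singleton,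
        Finset.range_add_one, Finset.filter_insert]
      have hcongr : (Finset.range l.length).filter (fun k =>
          ((l ++ [g])[k]?).any Gate.isBinary = true) = (Finset.range l.length).filter (fun k =>
          (l[k]?).any Gate.isBinary = true) := by
        refine Finset.filter_congr fun k hk => ?_
        rw [List.getElem?_append_left (Finset.mem_range.1 hk)]
      rw [hcongr]
      by_cases hg : g.isBinary = true
      · simp [hg]
      · simp [hg]
  exact key C.gates

/-- Every wire of a circuit carries a function that is available from its binary gates. -/
theorem Circuit.avail_wireVal (C : Circuit n) (k : ℕ) : k ≤ C.gates.length → ∀ w : Wire n,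
    w.Before k → Avail Finset.univ (C.binaries.filter (· < k)) (fun j => C.wireVal (.gate j))
      (C.wireVal w) := by
  induction k using Nat.strong_induction_on with
  | _ k ih =>
    rintro hk (i | j) hw
    · exact .inr (.inl ⟨i, Finset.mem_univ i, false, fun u => by simp [wireVal, Wire.eval]⟩)
    · have hjk : j < k := hw
      have hj : j < C.gates.length := hjk.trans_le hk
      have hg := List.getElem?_eq_getElem hj
      have hval := fun u => C.wireVal_gate u hg
      have hbin : C.gates[j].isBinary = true → Avail Finset.univ (C.binaries.filter (· < k))
          (fun j => C.wireVal (.gate j)) (C.wireVal (.gate j)) := fun hb =>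
        .inr (.inr ⟨j, Finset.mem_filter.2 ⟨C.mem_binaries.2 ⟨_, hg, hb⟩, hjk⟩, false,
          fun u => by simp⟩)
      cases hgj : C.gates[j] with
      | const b => exact .inl ⟨b, fun u => by rw [hval, hgj]; rfl⟩
      | neg a =>
        refine ((ih j hjk hj.le a (C.acyclic j _ hg a (by simp [hgj, Gate.reads]))).mono ?_).xor
          true fun u => by rw [hval, hgj]; simp [Gate.evalWith]
        intro l hl
        rw [Finset.mem_filter] at hl ⊢
        exact ⟨hl.1, hl.2.trans hjk⟩
      | conj a b => exact hbin (by rw [hgj]; rfl)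
      | disj a b => exact hbin (by rw [hgj]; rfl)

theorem Circuit.chain (C : Circuit n) :
    Chain Finset.univ C.binaries (fun j => C.wireVal (.gate j)) := by
  intro k hk
  obtain ⟨g, hg, hb⟩ := C.mem_binaries.1 hk
  have hkl := (List.getElem?_eq_some_iff.1 hg).1.le
  have hval := fun u => C.wireVal_gate u hg
  have hav := fun w hw => C.avail_wireVal k hkl w (C.acyclic k g hg w hw)
  cases g with
  | const b => simp [Gate.isBinary] at hb
  | neg a => simp [Gate.isBinary] at hb
  | conj a b =>
    exact ⟨_, _, false, hav a (by simp [Gate.reads]), hav b (by simp [Gate.reads]),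
      fun u => by simp [hval, Gate.evalWith]⟩
  | disj a b =>
    exact ⟨_, _, true, (hav a (by simp [Gate.reads])).xor true fun u => rfl,
      (hav b (by simp [Gate.reads])).xor true fun u => rfl,
      fun u => by simp [hval, Gate.evalWith]⟩

theorem Avail.degLT {ι : Type*} {S : Finset ι} {G : Finset ℕ} {v : ℕ → (ι → Bool) → Bool}
    {p : (ι → Bool) → Bool} (h : Avail S G v p) (hv : ∀ k ∈ G, DegLT 3 (v k)) : DegLT 3 p := by
  rcases h with ⟨c, h⟩ | ⟨i, -, s, h⟩ | ⟨j, hj, s, h⟩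
  · rw [show p = _ from funext h]
    exact (DegLT.const c).mono (by omega)
  · rw [show p = _ from funext h]
    exact ((DegLT.const s).mono (by omega)).xor ((DegLT.coord i).mono (by omega))
  · rw [show p = _ from funext h]
    exact ((DegLT.const s).mono (by omega)).xor (hv j hj)

/-- In a circuit of size `3 * (n - 1)` for parity or its negation, each wire carries a function of
degree at most 2. -/
theorem Circuit.wireVal_degLT (C : Circuit n) (hn : 1 ≤ n) (hsize : C.size = 3 * (n - 1))
    {s : Bool} (hC : ∀ u, C.eval u = (s ^^ xorFn n u)) {w : Wire n}
    (hw : w.Before C.gates.length) : DegLT 3 (C.wireVal w) := by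
  have hsens : Sensitive Finset.univ (C.wireVal C.output) := by
    intro u i _
    have h1 := hC (Function.update u i (!u i))
    rw [update_not_eq_xorVec, xorFn_xorVec, xorFn_unitVec] at h1
    rw [update_not_eq_xorVec]
    refine h1.trans ?_
    rw [show C.wireVal C.output u = (s ^^ xorFn n u) from hC u]
    simp
  have hav := fun w hw => (C.avail_wireVal _ le_rfl w hw).mono (Finset.filter_subset _ _)
  have := card_eq_and_degLT_of_chain (n - 1) (by simp; omega) C.chain
    (hav _ C.output_valid) hsens (by rw [C.card_binaries, hsize])
  exact (hav w hw).degLT this.2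

end Values

/-! ### Tests on subcubes with four directions: soundness and completeness. -/

section Subcubes

/-- The linear form with coefficients `c` in four variables. -/
def linForm (c t : Fin 4 → Bool) : Bool :=
  (t 0 && c 0) ^^ (t 1 && c 1) ^^ (t 2 && c 2) ^^ (t 3 && c 3)

theorem linForm_xorVec (c s t : Fin 4 → Bool) :
    linForm c (xorVec s t) = (linForm c s ^^ linForm c t) := by
  simp only [linForm, xorVec]
  simp only [Bool.and_xor_distrib_right, Bool.xor_assoc, Bool.xor_left_comm]

/-- The points of the subcube with the directions `p`, where direction `0` stands for the zero
vector and direction `i + 1` for the unit vector `i`. -/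
def subcube {n : ℕ} (p : Fin 4 → ℕ) (t : Fin 4 → Bool) : Fin n → Bool :=
  fun i => linForm (fun r => decide (p r = i + 1)) t

variable {n : ℕ}

theorem subcube_xorVec (p : Fin 4 → ℕ) (s t : Fin 4 → Bool) :
    (subcube p (xorVec s t) : Fin n → Bool) = xorVec (subcube p s) (subcube p t) :=
  funext fun _ => linForm_xorVec _ _ _

theorem subcube_false (p : Fin 4 → ℕ) :
    (subcube p (fun _ => false) : Fin n → Bool) = fun _ => false := by
  funext i; simp [subcube, linForm]

theorem subcube_unitVec {p : Fin 4 → ℕ} {r : Fin 4} {i : Fin n} (hr : p r = i + 1) :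
    subcube p (unitVec r) = unitVec i := by
  funext j
  have : decide (p r = j + 1) = decide (j = i) := by
    rw [hr, decide_eq_decide, Fin.ext_iff]
    omega
  rw [unitVec, ← this]
  fin_cases r <;> simp [subcube, linForm, unitVec]

/-- A point of the subcube is the sum of the chosen directions, and each nonzero one contributes
parity 1. This holds also for coinciding directions, since they are added modulo 2. -/
theorem xorFn_subcube {p : Fin 4 → ℕ} (hp : ∀ r, p r ≤ n) (t : Fin 4 → Bool) :
    xorFn n (subcube p t) = linForm (fun r => !decide (p r = 0)) t := by
  have part : ∀ r, xorFn n (fun i => t r && decide (p r = i + 1)) =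
      (t r && !decide (p r = 0)) := by
    intro r
    cases t r
    · simpa using xorFn_false
    by_cases h : p r = 0
    · simpa [h] using xorFn_false
    · have : (fun i : Fin n => true && decide (p r = i + 1)) =
          unitVec (⟨p r - 1, by have := hp r; omega⟩ : Fin n) := by
        funext i
        rw [Bool.true_and, unitVec, decide_eq_decide, Fin.ext_iff]
        change p r = i + 1 ↔ (i : ℕ) = p r - 1
        omega
      rw [this, xorFn_unitVec]
      simp [h]
  have hsum : (subcube p t : Fin n → Bool) = xorVec (xorVec (xorVec
      (fun i : Fin n => t 0 && decide (p 0 = i + 1)) (fun i : Fin n => t 1 && decide (p 1 = i + 1)))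
      (fun i : Fin n => t 2 && decide (p 2 = i + 1))) (fun i : Fin n => t 3 && decide (p 3 = i + 1)) := rfl
  rw [hsum, xorFn_xorVec, xorFn_xorVec, xorFn_xorVec, part, part, part, part]
  rfl

theorem diff_comp_subcube (p : Fin 4 → ℕ) (a : Fin 4 → Bool) (f : (Fin n → Bool) → Bool) :
    diff a (fun t => f (subcube p t)) = fun t => diff (subcube p a) f (subcube p t) := by
  funext t
  simp only [diff, subcube_xorVec]

/-- On the subcube with directions `p`, all gates of the circuit have degree at most 2, and the
output is `s` plus parity. -/
def Circuit.Passes (C : Circuit n) (s : Bool) (p : Fin 4 → ℕ) : Prop :=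
  (∀ k < C.gates.length, DegLT 3 fun t => C.wireVal (.gate k) (subcube p t)) ∧
    ∀ t, C.eval (subcube p t) = (s ^^ linForm (fun r => !decide (p r = 0)) t)

/-- The degree of a function of degree at most 4 can be tested on subcubes. -/
theorem DegLT.of_subcubes {f : (Fin n → Bool) → Bool} (hf : DegLT 5 f)
    (h : ∀ p : Fin 4 → ℕ, (∀ r, p r ≤ n) → DegLT 3 fun t => f (subcube p t)) : DegLT 3 f := by
  have main : ∀ i j k l : Fin n, ∀ t,
      diff (unitVec i) (diff (unitVec j) (diff (unitVec k) f))
        (subcube ![i + 1, j + 1, k + 1, l + 1] t) = false ∧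
      diff (unitVec i) (diff (unitVec j) (diff (unitVec k) (diff (unitVec l) f)))
        (subcube ![i + 1, j + 1, k + 1, l + 1] t) = false := by
    intro i j k l t
    have hp := h ![i + 1, j + 1, k + 1, l + 1] (by
      intro r; fin_cases r <;> simp)
    have h3 := hp (unitVec 2) (unitVec 1) (unitVec 0) t
    have h4 := hp.succ (unitVec 3) (unitVec 2) (unitVec 1) (unitVec 0) t
    simp only [diff_comp_subcube] at h3 h4
    rw [subcube_unitVec (r := 0) (i := i) rfl, subcube_unitVec (r := 1) (i := j) rfl,
      subcube_unitVec (r := 2) (i := k) rfl] at h3 h4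
    rw [subcube_unitVec (r := 3) (i := l) rfl] at h4
    exact ⟨h3, h4⟩
  refine of_diff_zero hf (fun i j k => ?_) fun i j k l => ?_
  -- The fourth direction does not matter for a coefficient of degree 3.
  · have := (main i j k k fun _ => false).1
    rwa [subcube_false] at this
  · have := (main i j k l fun _ => false).2
    rwa [subcube_false] at this

/-- The test on all subcubes is complete. -/
theorem Circuit.passes_of_eval_eq (C : Circuit n) (hn : 1 ≤ n) (hsize : C.size = 3 * (n - 1))
    {s : Bool} (hC : ∀ u, C.eval u = (s ^^ xorFn n u)) {p : Fin 4 → ℕ} (hp : ∀ r, p r ≤ n) :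
    C.Passes s p :=
  ⟨fun k hk => (C.wireVal_degLT hn hsize hC (w := .gate k) hk).comp_additive (subcube_xorVec p),
    fun t => by rw [hC, xorFn_subcube hp]⟩

/-- The test on all subcubes is sound. -/
theorem Circuit.eval_eq_of_passes (C : Circuit n) {s : Bool}
    (h : ∀ p : Fin 4 → ℕ, (∀ r, p r ≤ n) → C.Passes s p) (u : Fin n → Bool) :
    C.eval u = (s ^^ xorFn n u) := by
  -- In topological order: both operands have degree at most 2, so the gate has degree at most 4,
  -- and the tests bring this down to 2 again.
  have hdeg : ∀ k ≤ C.gates.length, ∀ w : Wire n, w.Before k → DegLT 3 (C.wireVal w) := by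
    intro k
    induction k using Nat.strong_induction_on with
    | _ k ih =>
      rintro hk (i | j) hw
      · exact (DegLT.coord i).succ
      · have hjk : j < k := hw
        have hj : j < C.gates.length := hjk.trans_le hk
        have hg := List.getElem?_eq_getElem hj
        have hwire := fun w hw => ih j hjk hj.le w (C.acyclic j _ hg w hw)
        refine DegLT.of_subcubes ?_ fun p hp => (h p hp).1 j hj
        rw [show C.wireVal (.gate j) = _ from funext fun u => C.wireVal_gate u hg]
        cases hgj : C.gates[j] with
        | const b => exact (DegLT.const b).mono (by omega)
        | neg a => exact ((hwire a (by simp [hgj, Gate.reads])).not (by omega)).mono (by omega)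
        | conj a b =>
          exact (hwire a (by simp [hgj, Gate.reads])).and (hwire b (by simp [hgj, Gate.reads]))
        | disj a b =>
          have := (((hwire a (by simp [hgj, Gate.reads])).not (by omega)).and
            ((hwire b (by simp [hgj, Gate.reads])).not (by omega))).not (by omega)
          simpa [Gate.evalWith] using this
  have hout := (hdeg _ le_rfl _ C.output_valid).xor
    (((DegLT.const s).mono (by omega)).xor (xorFn_degLT (n := n)).succ)
  have hzero : ∀ p : Fin 4 → ℕ, (∀ r, p r ≤ n) → ∀ t,
      (C.wireVal C.output (subcube p t) ^^ (s ^^ xorFn n (subcube p t))) = false := by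
    intro p hp t
    rw [xorFn_subcube hp, ← (h p hp).2 t]
    exact Bool.xor_self _
  have main : ∀ i j : Fin n,
      diff (unitVec i) (fun u => C.wireVal C.output u ^^ (s ^^ xorFn n u)) (fun _ => false) =
        false ∧
      diff (unitVec i) (diff (unitVec j) fun u => C.wireVal C.output u ^^ (s ^^ xorFn n u))
        (fun _ => false) = false := by
    intro i j
    -- The difference between output and target has degree at most 2, so two directions suffice; the
    -- other two are zero.
    have hp : ∀ r, (![(i : ℕ) + 1, j + 1, 0, 0] : Fin 4 → ℕ) r ≤ n := by
      intro r; fin_cases r <;> simp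
    have h0 : DegLT 0 fun t => C.wireVal C.output (subcube ![(i : ℕ) + 1, j + 1, 0, 0] t) ^^
      (s ^^ xorFn n (subcube ![(i : ℕ) + 1, j + 1, 0, 0] t)) := hzero _ hp
    have h1 := h0.succ (unitVec 0) fun _ => false
    have h2 := h0.succ.succ (unitVec 1) (unitVec 0) fun _ => false
    rw [diff_comp_subcube _ _ fun u => C.wireVal C.output u ^^ (s ^^ xorFn n u)] at h1 h2
    rw [diff_comp_subcube] at h2
    beta_reduce at h1 h2
    rw [subcube_unitVec (r := 0) (i := i) rfl, subcube_false] at h1 h2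
    rw [subcube_unitVec (r := 1) (i := j) rfl] at h2
    exact ⟨h1, h2⟩
  have hfalse := hout.eq_false_of_diff_zero ?_ (fun i => (main i i).1) (fun i j => (main i j).2) u
  · exact (by decide : ∀ a b : Bool, (a ^^ b) = false → a = b) _ _ hfalse
  · have := hzero (fun _ => 0) (fun _ => Nat.zero_le _) fun _ => false
    rwa [subcube_false] at this

open Classical in
/-- The right answer for a circuit of size `3 * (n - 1)` can be read off from the tests on all
subcubes. -/
theorem Circuit.verdict_eq (C : Circuit n) (hn : 1 ≤ n) (hsize : C.size = 3 * (n - 1)) :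
    C.verdict = if ∀ p : Fin 4 → ℕ, (∀ r, p r ≤ n) → C.Passes false p then .isXor
      else if ∀ p : Fin 4 → ℕ, (∀ r, p r ≤ n) → C.Passes true p then .isNegXor else .neither := by
  have key : ∀ s, (∀ p : Fin 4 → ℕ, (∀ r, p r ≤ n) → C.Passes s p) ↔
      ∀ u, C.eval u = (s ^^ xorFn n u) := fun s =>
    ⟨fun h => C.eval_eq_of_passes h, fun h p hp => C.passes_of_eval_eq hn hsize h hp⟩
  rw [Circuit.verdict]
  simp only [key, Bool.false_xor, Bool.true_xor]

end Subcubes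

end XorDetect

namespace XorDetect

/-! ### The machine and its step relation. -/

section Machine

/-- The truth table of the restriction of a wire to a subcube. -/
abbrev Val := (Fin 4 → Bool) → Bool

/-- The cells of the machine contain, for each input variable, the set of the directions of the
subcube that are equal to it, and for each gate the truth table of its value. -/
abbrev Cell := (Fin 4 → Bool) ⊕ Val

/-- The stacks of the machine: input, output, the part of the circuit description that is still
to be read and the part that has been read, and the cells before and after the current wire. -/
inductive Stack where
  | inp | out | todo | done | left | right
  deriving DecidableEq

/-- The alphabets of the stacks. -/
abbrev Stack.Alphabet : Stack → Type
  | .inp | .todo | .done => Sym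
  | .out => Verdict
  | .left | .right => Cell

/-- The labels of the machine. -/
inductive Label where
  | cells | load | back | token | rewind | skip | forward | drop | restore | shift | clear
  deriving DecidableEq

/-- The control state: the results of the tests so far (for parity and for its negation), the set of
the directions that are zero, the direction that is being moved, the type of the current gate,
the symbol and the cell that were read last, and the values of the operands of the current gate. -/
structure Control where
  ok : Bool → Bool
  zero : Fin 4 → Bool
  digit : Fin 4
  cur : Sym
  sym : Option Sym
  cell : Option Cell
  fst : Val
  snd : Val

instance : Fintype Stack where
  elems := {.inp, .out, .todo, .done, .left, .right}
  complete s := by cases s <;> simp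

instance : Fintype Label where
  elems := {.cells, .load, .back, .token, .rewind, .skip, .forward, .drop, .restore, .shift, .clear}
  complete s := by cases s <;> simp

instance : Fintype Sym where
  elems := {.tick, .input, .gate, .const true, .const false, .neg, .conj, .disj, .output}
  complete s := by
    cases s with
    | const b => cases b <;> simp
    | _ => simp

instance : Fintype Verdict where
  elems := {.isXor, .isNegXor, .neither}
  complete s := by cases s <;> simp

noncomputable instance : Fintype Control :=
  Fintype.ofInjective (β := (Bool → Bool) × (Fin 4 → Bool) × Fin 4 × Sym × Option Sym ×
      Option Cell × Val × Val)
    (fun s => (s.ok, s.zero, s.digit, s.cur, s.sym, s.cell, s.fst, s.snd))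
    fun s t h => by
      cases s
      cases t
      simpa using h

/-- The alphabets of all stacks are finite, not only that of the input, as `Turing.FinTM2` requires. -/
instance (k : Stack) : Fintype k.Alphabet := by
  cases k <;> exact inferInstance

/-- The value of a cell. -/
def Cell.val : Cell → Val
  | .inl c => linForm c
  | .inr v => v

/-- The set of directions that a cell contains. -/
def Cell.dirs : Cell → Fin 4 → Bool
  | .inl c => c
  | .inr _ => fun _ => false

/-- The value of a gate. -/
def Sym.gateVal : Sym → Val → Val → Val
  | .const b, _, _ => fun _ => b
  | .neg, _, w => fun t => !w t
  | .conj, v, w => fun t => v t && w t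
  | .disj, v, w => fun t => v t || w t
  | _, _, _ => fun _ => false

open Classical in
/-- Whether a truth table has degree at most 2. -/
noncomputable def lowDegree (v : Val) : Bool := decide (DegLT 3 v)

/-- Whether a truth table is `b` plus the sum of the directions that are not zero. -/
def isParity (zero : Fin 4 → Bool) (b : Bool) (v : Val) : Bool :=
  decide (∀ t, v t = (b ^^ linForm (fun r => !zero r) t))

namespace Control

/-- The initial control state. -/
def init : Control where
  ok _ := true
  zero _ := true
  digit := 0
  cur := .tick
  sym := none
  cell := none
  fst _ := false
  snd _ := false

/-- The symbol that was read last. -/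
def symD (s : Control) : Sym := s.sym.getD .tick

/-- The cell that was read last. -/
def cellD (s : Control) : Cell := s.cell.getD (.inl fun _ => false)

/-- Whether the cell that was read last belongs to an input variable. -/
def isInput (s : Control) : Bool := (s.cell.map Sum.isLeft).getD false

/-- The value of the cell that was read last becomes the value of the second operand. -/
def takeOperand (s : Control) : Control := { s with fst := s.snd, snd := s.cellD.val }

/-- The value of the current gate. -/
def value (s : Control) : Val := s.cur.gateVal s.fst s.snd

/-- Test the degree of the value of the current gate. -/
noncomputable def testGate (s : Control) : Control :=
  { s with ok := fun b => s.ok b && lowDegree s.value }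

/-- Test the value of the output. -/
def testOutput (s : Control) : Control :=
  { s with ok := fun b => s.ok b && isParity s.zero b s.snd }

/-- The bit for the direction that is being moved, in the last cell and in the register `zero`, is
exchanged. -/
def exchange (s : Control) : Control :=
  { s with zero := Function.update s.zero s.digit (s.cellD.dirs s.digit) }

/-- The last cell after the exchange. -/
def exchanged (s : Control) : Cell :=
  .inl (Function.update s.cellD.dirs s.digit (s.zero s.digit))

/-- The verdict. -/
def verdict (s : Control) : Verdict :=
  if s.ok false then .isXor else if s.ok true then .isNegXor else .neither

end Control

open Turing.TM2.Stmt

/-- The program of the machine. First `cells` creates one cell for each variable, `load` and `back`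
move the description of the gates to the stack `todo`. For each subcube, `token` then reads the
description and evaluates the gates; `rewind` and `skip` prepare the search for a wire, and
`forward` appends a cell for a gate. Afterwards, `drop` and `restore` delete the cells of the gates,
and `shift` moves to the next subcube; finally, `clear` empties the stacks. -/
noncomputable def program :
    Label → Turing.TM2.Stmt Stack.Alphabet Label Control
  | .cells =>
    pop .inp (fun s x => { s with sym := x }) <|
    branch (fun s => s.symD = .tick)
      (push .left (fun _ => Sum.inl fun _ => false) <| goto fun _ => .cells)
      (push .done Control.symD <| goto fun _ => .load)
  | .load =>
    pop .inp (fun s x => { s with sym := x }) <|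
    branch (fun s => s.sym.isSome)
      (push .done Control.symD <| goto fun _ => .load)
      (goto fun _ => .back)
  | .back =>
    pop .done (fun s x => { s with sym := x }) <|
    branch (fun s => s.sym.isSome)
      (push .todo Control.symD <| goto fun _ => .back)
      (load (fun s => { s with cur := .tick }) <| goto fun _ => .token)
  | .token =>
    pop .todo (fun s x => { s with sym := x }) <|
    branch (fun s => s.sym.isSome)
      (push .done Control.symD <|
        branch (fun s => s.symD = .tick)
          (pop .right (fun s x => { s with cell := x }) <|
            branch (fun s => s.cell.isSome)
              (push .left Control.cellD <| goto fun _ => .token)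
              (goto fun _ => .token))
          (peek .right (fun s x => { s with cell := x }) <|
            load Control.takeOperand <|
            branch (fun s => s.symD = .input || s.symD = .gate)
              (goto fun _ => .rewind)
              (goto fun _ => .forward)))
      (peek .right (fun s x => { s with cell := x }) <|
        load (fun s => { s.takeOperand.testOutput with digit := 0 }) <| goto fun _ => .drop)
  | .rewind =>
    pop .left (fun s x => { s with cell := x }) <|
    branch (fun s => s.cell.isSome)
      (push .right Control.cellD <| goto fun _ => .rewind)
      (branch (fun s => s.symD = .gate) (goto fun _ => .skip) (goto fun _ => .token))
  | .skip =>
    peek .right (fun s x => { s with cell := x }) <|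
    branch Control.isInput
      (pop .right (fun s x => { s with cell := x }) <|
        push .left Control.cellD <| goto fun _ => .skip)
      (goto fun _ => .token)
  | .forward =>
    pop .right (fun s x => { s with cell := x }) <|
    branch (fun s => s.cell.isSome)
      (push .left Control.cellD <| goto fun _ => .forward)
      (branch (fun s => s.cur = .tick)
        (load (fun s => { s with cur := s.symD }) <| goto fun _ => .token)
        (push .left (fun s => Sum.inr s.value) <|
          load (fun s => { s.testGate with cur := s.symD }) <| goto fun _ => .token))
  | .drop =>
    pop .right (fun s x => { s with cell := x }) <|
    branch (fun s => s.cell.isSome)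
      (branch Control.isInput
        (push .left Control.cellD <| goto fun _ => .drop)
        (goto fun _ => .drop))
      (goto fun _ => .restore)
  | .restore =>
    pop .left (fun s x => { s with cell := x }) <|
    branch (fun s => s.cell.isSome)
      (branch Control.isInput
        (push .right Control.cellD <| goto fun _ => .restore)
        (goto fun _ => .restore))
      (goto fun _ => .shift)
  | .shift =>
    pop .right (fun s x => { s with cell := x }) <|
    branch (fun s => s.cell.isSome)
      (push .left Control.exchanged <| load Control.exchange <| goto fun _ => .shift)
      (branch (fun s => s.zero s.digit)
        (branch (fun s => s.digit = 3)
          (goto fun _ => .clear)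
          (load (fun s => { s with digit := s.digit + 1 }) <| goto fun _ => .restore))
        (goto fun _ => .back))
  | .clear =>
    pop .done (fun s x => { s with sym := x }) <|
    pop .left (fun s x => { s with cell := x }) <|
    branch (fun s => s.sym.isSome || s.cell.isSome)
      (goto fun _ => .clear)
      (push .out Control.verdict <| load (fun _ => Control.init) <| halt)

/-- The machine. -/
noncomputable def machine : Turing.TM2ComputableAux Sym Verdict where
  tm :=
    { K := Stack
      k₀ := .inp
      k₁ := .out
      Γ := Stack.Alphabet
      Λ := Label
      main := .cells
      σ := Control
      initialState := Control.init
      m := program }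
  inputAlphabet := Equiv.refl _
  outputAlphabet := Equiv.refl _

/-- The contents of the stacks. -/
def tapes (inp : List Sym) (out : List Verdict) (todo done : List Sym) (left right : List Cell) :
    ∀ k : Stack, List k.Alphabet
  | .inp => inp
  | .out => out
  | .todo => todo
  | .done => done
  | .left => left
  | .right => right

section Stacks

variable (inp inp' : List Sym) (out out' : List Verdict) (todo todo' done done' : List Sym)
  (left left' right right' : List Cell)

@[simp] theorem update_inp : Function.update (tapes inp out todo done left right) .inp inp' =
    tapes inp' out todo done left right := by
  funext k; cases k <;> rfl

@[simp] theorem update_out : Function.update (tapes inp out todo done left right) .out out' =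
    tapes inp out' todo done left right := by
  funext k; cases k <;> rfl

@[simp] theorem update_todo : Function.update (tapes inp out todo done left right) .todo todo' =
    tapes inp out todo' done left right := by
  funext k; cases k <;> rfl

@[simp] theorem update_done : Function.update (tapes inp out todo done left right) .done done' =
    tapes inp out todo done' left right := by
  funext k; cases k <;> rfl

@[simp] theorem update_left : Function.update (tapes inp out todo done left right) .left left' =
    tapes inp out todo done left' right := by
  funext k; cases k <;> rfl

@[simp] theorem update_right :
    Function.update (tapes inp out todo done left right) .right right' =
      tapes inp out todo done left right' := by
  funext k; cases k <;> rfl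

end Stacks

/-- The configurations of the machine. -/
abbrev Config := Turing.TM2.Cfg Stack.Alphabet Label Control

/-- From the first configuration, the machine reaches the second one in at most `t` steps. -/
inductive Runs : Config → ℕ → Config → Prop
  | refl (c : Config) (t : ℕ) : Runs c t c
  | head {c c' c'' : Config} {t : ℕ} : Turing.TM2.step program c = some c' → Runs c' t c'' →
      Runs c (t + 1) c''

namespace Runs

theorem mono {c c' : Config} {t t' : ℕ} (h : Runs c t c') (ht : t ≤ t') : Runs c t' c' := by
  induction h generalizing t' with
  | refl c t => exact .refl c t'
  | head hstep _ ih =>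
    obtain ⟨t', rfl⟩ := Nat.exists_eq_add_of_le' (show 1 ≤ t' by omega)
    exact .head hstep (ih (by omega))

theorem trans {c c' c'' : Config} {t t' : ℕ} (h : Runs c t c') (h' : Runs c' t' c'') :
    Runs c (t + t') c'' := by
  induction h with
  | refl c t => exact h'.mono (by omega)
  | head hstep _ ih => exact (Runs.head hstep (ih h')).mono (by omega)

theorem of_step {c c' c'' : Config} {t t' : ℕ} (h : Turing.TM2.step program c = some c')
    (h' : Runs c' t c'') (ht : t + 1 ≤ t') : Runs c t' c'' :=
  (Runs.head h h').mono ht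

theorem evalsToInTime {c c' : Config} {t : ℕ} (h : Runs c t c') :
    Nonempty (StateTransition.EvalsToInTime (Turing.TM2.step program) c (some c') t) := by
  induction h with
  | refl c t => exact ⟨⟨⟨0, rfl⟩, Nat.zero_le t⟩⟩
  | head hstep _ ih =>
    obtain ⟨⟨⟨k, hk⟩, hle⟩⟩ := ih
    refine ⟨⟨⟨k + 1, ?_⟩, Nat.succ_le_succ hle⟩⟩
    rw [Function.iterate_succ_apply]
    simpa [flip, hstep] using hk

end Runs

end Machine

end XorDetect

namespace XorDetect

/-! ### The single loops of the program. -/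

section Loops

/-- The end of the unary `n` is noticed only after popping the symbol behind it, so this symbol is
saved on `done`. -/
theorem runs_cells (n : ℕ) (t : Sym) (ht : t ≠ .tick) (inp todo done : List Sym)
    (right : List Cell) : ∀ (left : List Cell) (s : Control),
    Runs ⟨some .cells, s, tapes (List.replicate n .tick ++ t :: inp) [] todo done left right⟩ (n + 1)
      ⟨some .load, { s with sym := some t }, tapes inp [] todo (t :: done)
        (List.replicate n (.inl fun _ => false) ++ left) right⟩ := by
  induction n with
  | zero =>
    intro left s
    exact .head (by simp [program, tapes, Control.symD, ht]) (.refl _ _)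
  | succ n ih =>
    intro left s
    have h := ih (.inl (fun _ => false) :: left) { s with sym := some .tick }
    refine .head (c' := ⟨some .cells, { s with sym := some .tick },
      tapes (List.replicate n .tick ++ t :: inp) [] todo done (.inl (fun _ => false) :: left)
        right⟩) ?_ ?_
    · simp [program, tapes, Control.symD, List.replicate_succ]
    · rwa [List.replicate_succ', List.append_assoc]

theorem runs_load (L : List Sym) (todo : List Sym) (left right : List Cell) :
    ∀ (done : List Sym) (s : Control),
    Runs ⟨some .load, s, tapes L [] todo done left right⟩ (L.length + 1)
      ⟨some .back, { s with sym := none }, tapes [] [] todo (L.reverse ++ done) left right⟩ := by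
  induction L with
  | nil => exact fun done s => .head (by simp [program, tapes]) (.refl _ _)
  | cons a L ih =>
    intro done s
    have h := ih (a :: done) { s with sym := some a }
    refine .head (c' := ⟨some .load, { s with sym := some a },
      tapes L [] todo (a :: done) left right⟩) ?_ ?_
    · simp [program, tapes, Control.symD]
    · simpa using h

theorem runs_back (D : List Sym) (left right : List Cell) : ∀ (todo : List Sym) (s : Control),
    Runs ⟨some .back, s, tapes [] [] todo D left right⟩ (D.length + 1)
      ⟨some .token, { s with sym := none, cur := .tick },
        tapes [] [] (D.reverse ++ todo) [] left right⟩ := by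
  induction D with
  | nil => exact fun todo s => .head (by simp [program, tapes]) (.refl _ _)
  | cons a D ih =>
    intro todo s
    have h := ih (a :: todo) { s with sym := some a }
    refine .head (c' := ⟨some .back, { s with sym := some a },
      tapes [] [] (a :: todo) D left right⟩) ?_ ?_
    · simp [program, tapes, Control.symD]
    · simpa using h

theorem runs_ticks (R₁ R₂ : List Cell) (todo : List Sym) :
    ∀ (done : List Sym) (left : List Cell) (s : Control), ∃ x y,
    Runs ⟨some .token, s, tapes [] [] (List.replicate R₁.length .tick ++ todo) done left (R₁ ++ R₂)⟩
      R₁.length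
      ⟨some .token, { s with sym := x, cell := y },
        tapes [] [] todo (List.replicate R₁.length .tick ++ done) (R₁.reverse ++ left) R₂⟩ := by
  induction R₁ with
  | nil => exact fun done left s => ⟨_, _, .refl _ _⟩
  | cons a R₁ ih =>
    intro done left s
    obtain ⟨x, y, h⟩ := ih (.tick :: done) (a :: left) { s with sym := some .tick, cell := some a }
    refine ⟨x, y, .head (c' := ⟨some .token, { s with sym := some .tick, cell := some a },
      tapes [] [] (List.replicate R₁.length .tick ++ todo) (.tick :: done) (a :: left)
        (R₁ ++ R₂)⟩) ?_ ?_⟩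
    · simp [program, tapes, Control.symD, Control.cellD, List.replicate_succ]
    · rw [List.length_cons, List.replicate_succ', List.append_assoc, List.reverse_cons,
        List.append_assoc]
      exact h

theorem runs_rewind (L : List Cell) (todo done : List Sym) :
    ∀ (right : List Cell) (s : Control),
    Runs ⟨some .rewind, s, tapes [] [] todo done L right⟩ (L.length + 1)
      ⟨some (if s.symD = .gate then .skip else .token), { s with cell := none },
        tapes [] [] todo done [] (L.reverse ++ right)⟩ := by
  induction L with
  | nil =>
    intro right s
    refine .head ?_ (.refl _ _)
    by_cases h : s.symD = .gate
    · have h' : Control.symD { s with cell := none } = .gate := h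
      simp [program, tapes, h, h']
    · have h' : Control.symD { s with cell := none } ≠ .gate := h
      simp [program, tapes, h, h']
  | cons a L ih =>
    intro right s
    have h := ih (a :: right) { s with cell := some a }
    refine .head (c' := ⟨some .rewind, { s with cell := some a },
      tapes [] [] todo done L (a :: right)⟩) ?_ ?_
    · simp [program, tapes, Control.cellD]
    · rw [List.reverse_cons, List.append_assoc]
      exact h

theorem runs_skip (L : List (Fin 4 → Bool)) (R : List Cell) (hR : ∀ c, R.head? ≠ some (.inl c))
    (todo done : List Sym) : ∀ (left : List Cell) (s : Control),
    Runs ⟨some .skip, s, tapes [] [] todo done left (L.map .inl ++ R)⟩ (L.length + 1)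
      ⟨some .token, { s with cell := R.head? },
        tapes [] [] todo done ((L.map .inl).reverse ++ left) R⟩ := by
  induction L with
  | nil =>
    intro left s
    refine .head ?_ (.refl _ _)
    have : Control.isInput { s with cell := R.head? } = false := by
      cases R with
      | nil => rfl
      | cons c R =>
        cases c with
        | inl c => exact absurd rfl (hR c)
        | inr v => rfl
    simp [program, tapes, this]
  | cons a L ih =>
    intro left s
    have h := ih (.inl a :: left) { s with cell := some (.inl a) }
    refine .head (c' := ⟨some .skip, { s with cell := some (.inl a) },
      tapes [] [] todo done (.inl a :: left) (L.map .inl ++ R)⟩) ?_ ?_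
    · simp [program, tapes, Control.cellD, Control.isInput]
    · rw [List.map_cons, List.reverse_cons, List.append_assoc]
      exact h

theorem runs_forward (R : List Cell) (todo done : List Sym) :
    ∀ (left : List Cell) (s : Control),
    Runs ⟨some .forward, s, tapes [] [] todo done left R⟩ (R.length + 1)
      (if s.cur = .tick then
        ⟨some .token, { s with cell := none, cur := s.symD },
          tapes [] [] todo done (R.reverse ++ left) []⟩
      else
        ⟨some .token, { s.testGate with cell := none, cur := s.symD },
          tapes [] [] todo done (.inr s.value :: (R.reverse ++ left)) []⟩) := by
  induction R with
  | nil =>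
    intro left s
    refine .head ?_ (.refl _ _)
    by_cases h : s.cur = .tick
    · simp [program, tapes, h, Control.symD]
    · simp [program, tapes, h, Control.symD, Control.testGate, Control.value]
  | cons a R ih =>
    intro left s
    have h := ih (a :: left) { s with cell := some a }
    refine .head (c' := ⟨some .forward, { s with cell := some a },
      tapes [] [] todo done (a :: left) R⟩) ?_ ?_
    · simp [program, tapes, Control.cellD]
    · rw [List.reverse_cons, List.append_assoc]
      exact h

theorem runs_drop (R : List Cell) (todo done : List Sym) :
    ∀ (left : List Cell) (s : Control),
    Runs ⟨some .drop, s, tapes [] [] todo done left R⟩ (R.length + 1)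
      ⟨some .restore, { s with cell := none },
        tapes [] [] todo done ((R.filter Sum.isLeft).reverse ++ left) []⟩ := by
  induction R with
  | nil => exact fun left s => .head (by simp [program, tapes]) (.refl _ _)
  | cons a R ih =>
    intro left s
    cases a with
    | inl c =>
      refine .head (c' := ⟨some .drop, { s with cell := some (.inl c) },
        tapes [] [] todo done (.inl c :: left) R⟩) ?_ ?_
      · simp [program, tapes, Control.cellD, Control.isInput]
      · rw [List.filter_cons_of_pos rfl, List.reverse_cons, List.append_assoc]
        exact ih (.inl c :: left) { s with cell := some (.inl c) }
    | inr v =>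
      refine .head (c' := ⟨some .drop, { s with cell := some (.inr v) },
        tapes [] [] todo done left R⟩) ?_ ?_
      · simp [program, tapes, Control.isInput]
      · simpa using ih left { s with cell := some (.inr v) }

theorem runs_restore (L : List Cell) (todo done : List Sym) :
    ∀ (right : List Cell) (s : Control),
    Runs ⟨some .restore, s, tapes [] [] todo done L right⟩ (L.length + 1)
      ⟨some .shift, { s with cell := none },
        tapes [] [] todo done [] ((L.filter Sum.isLeft).reverse ++ right)⟩ := by
  induction L with
  | nil => exact fun right s => .head (by simp [program, tapes]) (.refl _ _)
  | cons a L ih =>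
    intro right s
    cases a with
    | inl c =>
      refine .head (c' := ⟨some .restore, { s with cell := some (.inl c) },
        tapes [] [] todo done L (.inl c :: right)⟩) ?_ ?_
      · simp [program, tapes, Control.cellD, Control.isInput]
      · rw [List.filter_cons_of_pos rfl, List.reverse_cons, List.append_assoc]
        exact ih (.inl c :: right) { s with cell := some (.inl c) }
    | inr v =>
      refine .head (c' := ⟨some .restore, { s with cell := some (.inr v) },
        tapes [] [] todo done L right⟩) ?_ ?_
      · simp [program, tapes, Control.isInput]
      · simpa using ih right { s with cell := some (.inr v) }

/-- Both stacks are popped in parallel and popping an empty stack is harmless, so the longer one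
determines the time. The control state is reset because `Turing.haltList` demands the initial one.
-/
theorem runs_clear (N : ℕ) : ∀ (D : List Sym) (L : List Cell) (s : Control),
    D.length ≤ N → L.length ≤ N →
    Runs ⟨some .clear, s, tapes [] [] [] D L []⟩ (N + 1)
      ⟨none, Control.init, tapes [] [s.verdict] [] [] [] []⟩ := by
  induction N with
  | zero =>
    intro D L s hD hL
    rw [List.length_eq_zero_iff.1 (Nat.le_zero.1 hD), List.length_eq_zero_iff.1 (Nat.le_zero.1 hL)]
    exact .head (by simp [program, tapes, Control.verdict]) (.refl _ _)
  | succ N ih =>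
    intro D L s hD hL
    by_cases h : D = [] ∧ L = []
    · rw [h.1, h.2]
      exact .head (by simp [program, tapes, Control.verdict]) (.refl _ _)
    · have hrest := ih D.tail L.tail { s with sym := D.head?, cell := L.head? }
        (by rw [List.length_tail]; omega) (by rw [List.length_tail]; omega)
      refine .head ?_ hrest
      have : (D.head?.isSome || L.head?.isSome) = true := by
        cases D with
        | nil =>
          cases L with
          | nil => simp at h
          | cons => rfl
        | cons => rfl
      simp [program, tapes, this]

end Loops

end XorDetect

namespace XorDetect

/-! ### Evaluation of the circuit on one subcube: reading a wire. -/

section Evaluation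

variable {n : ℕ}

/-- The cells of the input variables. -/
def inputCells (n : ℕ) (p : Fin 4 → ℕ) : List (Fin 4 → Bool) :=
  (List.range n).map fun m r => decide (p r = m + 1)

/-- The truth table of a wire on a subcube. -/
def Circuit.table (C : Circuit n) (p : Fin 4 → ℕ) (w : Wire n) : Val :=
  fun t => C.wireVal w (subcube p t)

/-- The cells of the first `k` gates. -/
def Circuit.gateCells (C : Circuit n) (p : Fin 4 → ℕ) (k : ℕ) : List Cell :=
  (List.range k).map fun j => .inr (C.table p (.gate j))

/-- The cells of the input variables and of the first `k` gates. -/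
def Circuit.cells (C : Circuit n) (p : Fin 4 → ℕ) (k : ℕ) : List Cell :=
  (inputCells n p).map .inl ++ C.gateCells p k

theorem Circuit.length_cells (C : Circuit n) (p : Fin 4 → ℕ) (k : ℕ) :
    (C.cells p k).length = n + k := by
  simp [cells, gateCells, inputCells]

theorem Circuit.cells_succ (C : Circuit n) (p : Fin 4 → ℕ) (k : ℕ) :
    C.cells p (k + 1) = C.cells p k ++ [.inr (C.table p (.gate k))] := by
  simp [cells, gateCells, List.range_succ]

/-- The value of the first cell of a stack. -/
def focus (R : List Cell) : Val := Cell.val (R.head?.getD (.inl fun _ => false))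

theorem focus_drop {R : List Cell} {i : ℕ} (hi : i < R.length) :
    focus (R.drop i) = Cell.val R[i] := by
  rw [focus, List.head?_drop, List.getElem?_eq_getElem hi]
  rfl

/-- Reading the operand `w`. -/
theorem runs_wire (C : Circuit n) (p : Fin 4 → ℕ) {k : ℕ} {w : Wire n} (hw : w.Before k)
    (todo done : List Sym) {L R : List Cell} (hLR : L.reverse ++ R = C.cells p k) (s : Control) :
    ∃ x y L' R', L'.reverse ++ R' = C.cells p k ∧ focus R' = C.table p w ∧
      Runs ⟨some .token, s, tapes [] [] (w.encode ++ todo) done L R⟩ (3 * (n + k) + 5)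
        ⟨some .token, { s with sym := x, cell := y, fst := s.snd, snd := focus R },
          tapes [] [] todo (w.encode.reverse ++ done) L' R'⟩ := by
  have hlen := C.length_cells p k
  have hL : L.length ≤ n + k := by
    rw [← hlen, ← hLR]; simp
  -- The tag stores what is on top of `right`, the previous operand, in `snd`. The cell for `w` ends
  -- up on top of `right` and is itself taken only at the next tag.
  cases w with
  | input i =>
    have hi : (i : ℕ) < (C.cells p k).length := by rw [hlen]; omega
    have hilen : ((C.cells p k).take i).length = i := by
      rw [List.length_take, min_eq_left hi.le]
    obtain ⟨x, y, hticks⟩ := runs_ticks ((C.cells p k).take i) ((C.cells p k).drop i) todo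
      (.input :: done) []
      { s with sym := some .input, cell := none, fst := s.snd, snd := focus R }
    rw [List.take_append_drop, hilen, List.append_nil] at hticks
    have hrewind := runs_rewind L (List.replicate i .tick ++ todo) (.input :: done) R
      { s with sym := some .input, cell := R.head?, fst := s.snd, snd := focus R }
    rw [hLR] at hrewind
    refine ⟨x, y, ((C.cells p k).take i).reverse, (C.cells p k).drop i, ?_, ?_, ?_⟩
    · rw [List.reverse_reverse, List.take_append_drop]
    · rw [focus_drop hi]
      simp [Circuit.cells, inputCells, Cell.val]
      rfl
    · have hdone : (Wire.input i : Wire n).encode.reverse ++ done =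
          List.replicate i .tick ++ .input :: done := by simp [Wire.encode]
      rw [hdone]
      refine .of_step ?_ (hrewind.trans hticks) ?_
      · simp [program, tapes, Wire.encode, Control.symD, Control.takeOperand, Control.cellD, focus]
      · omega
  | gate j =>
    have hjk : j < k := hw
    have hj : j < (C.gateCells p k).length := by simpa [Circuit.gateCells] using hjk
    have hjlen : ((C.gateCells p k).take j).length = j := by
      rw [List.length_take, min_eq_left hj.le]
    have hhead : ∀ c, (C.gateCells p k).head? ≠ some (.inl c) := by
      intro c hc
      have := List.mem_of_mem_head? hc
      simp [Circuit.gateCells] at this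
    have hskip := runs_skip (inputCells n p) (C.gateCells p k) hhead
      (List.replicate j .tick ++ todo) (.gate :: done) []
      { s with sym := some .gate, cell := none, fst := s.snd, snd := focus R }
    obtain ⟨x, y, hticks⟩ := runs_ticks ((C.gateCells p k).take j) ((C.gateCells p k).drop j) todo
      (.gate :: done) (((inputCells n p).map .inl).reverse ++ [])
      { s with sym := some .gate, cell := (C.gateCells p k).head?, fst := s.snd, snd := focus R }
    rw [List.take_append_drop, hjlen] at hticks
    have hrewind := runs_rewind L (List.replicate j .tick ++ todo) (.gate :: done) R
      { s with sym := some .gate, cell := R.head?, fst := s.snd, snd := focus R }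
    rw [hLR] at hrewind
    refine ⟨x, y, ((C.gateCells p k).take j).reverse ++ (((inputCells n p).map .inl).reverse ++ []),
      (C.gateCells p k).drop j, ?_, ?_, ?_⟩
    · simp [Circuit.cells]
    · rw [focus_drop hj]
      simp [Circuit.gateCells, Cell.val]
    · have hdone : (Wire.gate j : Wire n).encode.reverse ++ done =
          List.replicate j .tick ++ .gate :: done := by simp [Wire.encode]
      rw [hdone]
      refine .of_step ?_ (hrewind.trans (hskip.trans hticks)) ?_
      · simp [program, tapes, Wire.encode, Control.symD, Control.takeOperand, Control.cellD, focus]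
      · simp only [inputCells, List.length_map, List.length_range]
        omega

end Evaluation

end XorDetect

namespace XorDetect

/-! ### Evaluation of the circuit on one subcube: gates and output. -/

section Evaluation

variable {n : ℕ}

/-- The machine has read the first `k` gates, and the value of the last one of them is about to be
computed. -/
structure AfterGates (C : Circuit n) (p : Fin 4 → ℕ) (ok : Bool → Bool) (k : ℕ) (s : Control)
    (L R : List Cell) : Prop where
  -- A gate is known to be complete only when the next header arrives, so its value is appended and
  -- tested one gate late: after `k` gates there are `k - 1` gate cells. For `k = 0` the truncated
  -- difference is right too.
  cells : L.reverse ++ R = C.cells p (k - 1)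
  first : k = 0 → s.cur = .tick
  pending : ∀ j, k = j + 1 → s.cur ≠ .tick ∧
    s.cur.gateVal s.snd (focus R) = C.table p (.gate j)
  zero_eq : s.zero = fun r => decide (p r = 0)
  ok_iff : ∀ b, s.ok b = true ↔ ok b = true ∧ ∀ j < k - 1, DegLT 3 (C.table p (.gate j))

theorem lowDegree_iff (v : Val) : lowDegree v = true ↔ DegLT 3 v := by
  simp [lowDegree]

/-- Reading the type of the next gate. -/
theorem runs_header (C : Circuit n) (p : Fin 4 → ℕ) {ok : Bool → Bool} {k : ℕ} {s : Control}
    {L R : List Cell} (h : AfterGates C p ok k s L R) {a : Sym} (ha : a ≠ .tick)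
    (ha' : a ≠ .input) (ha'' : a ≠ .gate) (todo done : List Sym) :
    ∃ s' L', L'.reverse = C.cells p k ∧ s'.cur = a ∧ (s'.zero = fun r => decide (p r = 0)) ∧
      (∀ b, s'.ok b = true ↔ ok b = true ∧ ∀ j < k, DegLT 3 (C.table p (.gate j))) ∧
      Runs ⟨some .token, s, tapes [] [] (a :: todo) done L R⟩ (n + k + 2)
        ⟨some .token, s', tapes [] [] todo (a :: done) L' []⟩ := by
  have hR : R.length ≤ n + k := by
    have := congrArg List.length h.cells
    rw [C.length_cells, List.length_append] at this
    omega
  have hforward := runs_forward R todo (a :: done) L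
    { s with sym := some a, cell := R.head?, fst := s.snd, snd := focus R }
  have hstep : Turing.TM2.step program ⟨some .token, s, tapes [] [] (a :: todo) done L R⟩ =
      some ⟨some .forward, { s with sym := some a, cell := R.head?, fst := s.snd, snd := focus R },
        tapes [] [] todo (a :: done) L R⟩ := by
    simp [program, tapes, Control.symD, Control.takeOperand, Control.cellD, focus, ha, ha', ha'']
  -- Before the first gate nothing is pending. This is recorded by `cur = .tick`, and no cell is
  -- appended.
  rcases Nat.eq_zero_or_pos k with rfl | hk
  · rw [if_pos (h.first rfl)] at hforward
    refine ⟨{ s with sym := some a, cell := none, fst := s.snd, snd := focus R, cur := a },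
      R.reverse ++ L, ?_, rfl, h.zero_eq, h.ok_iff,
      .of_step (t := R.length + 1) hstep hforward (by omega)⟩
    simpa using h.cells
  · obtain ⟨j, rfl⟩ := Nat.exists_eq_add_of_le' hk
    obtain ⟨hcur, hval⟩ := h.pending j rfl
    rw [if_neg hcur] at hforward
    refine ⟨{ ({ s with sym := some a, cell := R.head?, fst := s.snd, snd := focus R } :
      Control).testGate with cell := none, cur := a }, _, ?_, rfl, h.zero_eq, ?_,
      .of_step (t := R.length + 1) hstep hforward (by omega)⟩
    · have hcells := h.cells
      rw [Nat.add_sub_cancel] at hcells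
      rw [C.cells_succ, ← hcells, ← hval]
      simp [Control.value]
    · intro b
      have hok := h.ok_iff b
      rw [Nat.add_sub_cancel] at hok
      simp only [Control.testGate, Bool.and_eq_true, hok, lowDegree_iff, Control.value]
      rw [hval, and_assoc, Nat.forall_lt_succ_right]

/-- Reading a gate. -/
theorem runs_gate (C : Circuit n) (p : Fin 4 → ℕ) {ok : Bool → Bool} {k : ℕ} {s : Control}
    {L R : List Cell} (h : AfterGates C p ok k s L R) {g : Gate n} (hg : C.gates[k]? = some g)
    (todo done : List Sym) :
    ∃ s' L' R', AfterGates C p ok (k + 1) s' L' R' ∧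
      Runs ⟨some .token, s, tapes [] [] (g.encode ++ todo) done L R⟩ (7 * (n + k) + 12)
        ⟨some .token, s', tapes [] [] todo (g.encode.reverse ++ done) L' R'⟩ := by
  have hval : C.table p (.gate k) = fun t => g.evalWith fun w => C.table p w t :=
    funext fun t => C.wireVal_gate (subcube p t) hg
  have hbefore := C.acyclic k g hg
  have two : ∀ (c : Sym) (a b : Wire n), c ≠ .tick → c ≠ .input → c ≠ .gate →
      g.encode = c :: (a.encode ++ b.encode) → a.Before k → b.Before k →
      C.table p (.gate k) = c.gateVal (C.table p a) (C.table p b) →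
      ∃ s' L' R', AfterGates C p ok (k + 1) s' L' R' ∧
      Runs ⟨some .token, s, tapes [] [] (g.encode ++ todo) done L R⟩ (7 * (n + k) + 12)
        ⟨some .token, s', tapes [] [] todo (g.encode.reverse ++ done) L' R'⟩ := by
    intro c a b hc hc' hc'' henc ha hb hv
    obtain ⟨s₁, L₁, hL₁, hcur, hzero, hok, h₁⟩ :=
      runs_header C p h hc hc' hc'' (a.encode ++ (b.encode ++ todo)) done
    obtain ⟨x₂, y₂, L₂, R₂, hL₂, hR₂, h₂⟩ := runs_wire C p ha (b.encode ++ todo) (c :: done)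
      (L := L₁) (R := []) (by simpa using hL₁) s₁
    obtain ⟨x₃, y₃, L₃, R₃, hL₃, hR₃, h₃⟩ := runs_wire C p hb todo
      (a.encode.reverse ++ c :: done) hL₂
      { s₁ with sym := x₂, cell := y₂, fst := s₁.snd, snd := focus [] }
    refine ⟨{ s₁ with sym := x₃, cell := y₃, fst := focus [], snd := focus R₂ }, L₃, R₃,
      ⟨hL₃, by simp, ?_, hzero, hok⟩, ?_⟩
    · intro j hj
      obtain rfl : k = j := by omega
      simp only [hcur, hR₂, hR₃]
      exact ⟨hc, hv.symm⟩
    · rw [henc]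
      simpa using (h₁.trans (h₂.trans h₃)).mono (t' := 7 * (n + k) + 12) (by omega)
  cases g with
  | const b =>
    obtain ⟨s₁, L₁, hL₁, hcur, hzero, hok, h₁⟩ :=
      runs_header C p h (a := .const b) (by simp) (by simp) (by simp) todo done
    refine ⟨s₁, L₁, [], ⟨by simpa using hL₁, by simp, ?_, hzero, hok⟩, ?_⟩
    · intro j hj
      obtain rfl : k = j := by omega
      rw [hcur, hval]
      exact ⟨by simp, rfl⟩
    · exact h₁.mono (by omega)
  | neg a =>
    obtain ⟨s₁, L₁, hL₁, hcur, hzero, hok, h₁⟩ :=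
      runs_header C p h (a := .neg) (by simp) (by simp) (by simp) (a.encode ++ todo) done
    obtain ⟨x₂, y₂, L₂, R₂, hL₂, hR₂, h₂⟩ := runs_wire C p
      (hbefore a (by simp [Gate.reads])) todo (.neg :: done)
      (L := L₁) (R := []) (by simpa using hL₁) s₁
    refine ⟨{ s₁ with sym := x₂, cell := y₂, fst := s₁.snd, snd := focus [] }, L₂, R₂,
      ⟨hL₂, by simp, ?_, hzero, hok⟩, ?_⟩
    · intro j hj
      obtain rfl : k = j := by omega
      simp only [hcur, hR₂, hval]
      exact ⟨by simp, rfl⟩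
    · simpa [Gate.encode] using (h₁.trans h₂).mono (t' := 7 * (n + k) + 12) (by omega)
  | conj a b =>
    exact two .conj a b (by simp) (by simp) (by simp) rfl (hbefore a (by simp [Gate.reads]))
      (hbefore b (by simp [Gate.reads])) hval
  | disj a b =>
    exact two .disj a b (by simp) (by simp) (by simp) rfl (hbefore a (by simp [Gate.reads]))
      (hbefore b (by simp [Gate.reads])) hval

/-- Reading all gates. -/
theorem runs_gates (C : Circuit n) (p : Fin 4 → ℕ) {ok : Bool → Bool} {s : Control}
    {L R : List Cell} (h : AfterGates C p ok 0 s L R) (done : List Sym) {k : ℕ} :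
    k ≤ C.gates.length → ∀ todo, ∃ s' L' R', AfterGates C p ok k s' L' R' ∧
      Runs ⟨some .token, s, tapes [] [] ((C.gates.take k).flatMap Gate.encode ++ todo) done L R⟩
        (k * (7 * (n + C.gates.length) + 12))
        ⟨some .token, s', tapes [] [] todo
          (((C.gates.take k).flatMap Gate.encode).reverse ++ done) L' R'⟩ := by
  induction k with
  | zero => exact fun _ todo => ⟨s, L, R, h, .refl _ _⟩
  | succ k ih =>
    intro hk todo
    have hg := List.getElem?_eq_getElem hk
    rw [List.take_succ_eq_append_getElem hk, List.flatMap_append, List.flatMap_singleton]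
    obtain ⟨s₁, L₁, R₁, h₁, hruns₁⟩ := ih (by omega) (C.gates[k].encode ++ todo)
    obtain ⟨s₂, L₂, R₂, h₂, hruns₂⟩ := runs_gate C p h₁ hg todo
      (((C.gates.take k).flatMap Gate.encode).reverse ++ done)
    refine ⟨s₂, L₂, R₂, h₂, ?_⟩
    rw [List.append_assoc, List.reverse_append, List.append_assoc]
    refine (hruns₁.trans hruns₂).mono ?_
    rw [Nat.add_one_mul k]
    exact Nat.add_le_add_left (by omega) _

/-- The description of a circuit, without the number of variables. -/
def Circuit.body (C : Circuit n) : List Sym :=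
  C.gates.flatMap Gate.encode ++ Sym.output :: C.output.encode

theorem filter_cells (C : Circuit n) (p : Fin 4 → ℕ) (k : ℕ) :
    (C.cells p k).filter Sum.isLeft = (inputCells n p).map .inl := by
  rw [Circuit.cells, List.filter_append, List.filter_eq_self.2, List.filter_eq_nil_iff.2,
    List.append_nil]
  · simp [Circuit.gateCells]
  · simp

/-- The test for one subcube. -/
theorem runs_subcube (C : Circuit n) (p : Fin 4 → ℕ) {s : Control} {L R : List Cell}
    (hcells : L.reverse ++ R = (inputCells n p).map .inl) (hcur : s.cur = .tick)
    (hzero : s.zero = fun r => decide (p r = 0)) :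
    ∃ s', s'.digit = 0 ∧ (s'.zero = fun r => decide (p r = 0)) ∧
      (∀ b, s'.ok b = true ↔ s.ok b = true ∧ C.Passes b p) ∧
      Runs ⟨some .token, s, tapes [] [] C.body [] L R⟩
        ((C.gates.length + 1) * (7 * (n + C.gates.length) + 12))
        ⟨some .shift, s', tapes [] [] [] C.body.reverse [] ((inputCells n p).map .inl)⟩ := by
  have h₀ : AfterGates C p s.ok 0 s L R :=
    ⟨by rw [hcells]; simp [Circuit.cells, Circuit.gateCells], fun _ => hcur, by simp, hzero, by simp⟩
  obtain ⟨s₁, L₁, R₁, h₁, hruns₁⟩ := runs_gates C p h₀ [] le_rfl (.output :: C.output.encode)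
  rw [List.take_length] at hruns₁
  -- The symbol `output` acts as one more header, which forces the evaluation of the last gate.
  obtain ⟨s₂, L₂, hL₂, -, hzero₂, hok₂, hruns₂⟩ := runs_header C p h₁ (a := .output) (by simp)
    (by simp) (by simp) C.output.encode ((C.gates.flatMap Gate.encode).reverse ++ [])
  obtain ⟨x₃, y₃, L₃, R₃, hL₃, hR₃, hruns₃⟩ := runs_wire C p C.output_valid []
    (.output :: ((C.gates.flatMap Gate.encode).reverse ++ [])) (L := L₂) (R := [])
    (by simpa using hL₂) s₂
  rw [List.append_nil] at hruns₃
  have hlen₃ : L₃.length + R₃.length = n + C.gates.length := by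
    rw [← C.length_cells p, ← hL₃]
    simp
  have hruns₅ := runs_drop R₃ [] (C.output.encode.reverse ++
    .output :: ((C.gates.flatMap Gate.encode).reverse ++ [])) L₃
    { ({ s₂ with sym := none, cell := R₃.head?, fst := focus [], snd := focus R₃ } :
      Control).testOutput with digit := 0 }
  have hruns₆ := runs_restore ((R₃.filter Sum.isLeft).reverse ++ L₃) [] (C.output.encode.reverse ++
    .output :: ((C.gates.flatMap Gate.encode).reverse ++ [])) []
    { ({ s₂ with sym := none, cell := none, fst := focus [], snd := focus R₃ } :
      Control).testOutput with digit := 0 }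
  have hcells₆ : (((R₃.filter Sum.isLeft).reverse ++ L₃).filter Sum.isLeft).reverse ++ [] =
      (inputCells n p).map .inl := by
    rw [← filter_cells C p C.gates.length, ← hL₃]
    simp [List.filter_reverse]
  have hbody : C.output.encode.reverse ++
      .output :: ((C.gates.flatMap Gate.encode).reverse ++ []) = C.body.reverse := by
    simp [Circuit.body]
  rw [hcells₆, hbody] at hruns₆
  rw [hbody] at hruns₃ hruns₅
  have hstep : Turing.TM2.step program ⟨some .token,
      { s₂ with sym := x₃, cell := y₃, fst := s₂.snd, snd := focus [] },
        tapes [] [] [] C.body.reverse L₃ R₃⟩ = some ⟨some .drop,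
      { ({ s₂ with sym := none, cell := R₃.head?, fst := focus [], snd := focus R₃ } :
        Control).testOutput with digit := 0 }, tapes [] [] [] C.body.reverse L₃ R₃⟩ := by
    simp [program, tapes, Control.takeOperand, Control.testOutput, Control.cellD, focus]
  refine ⟨{ ({ s₂ with sym := none, cell := none, fst := focus [], snd := focus R₃ } :
      Control).testOutput with digit := 0 }, rfl, hzero₂, ?_, (hruns₁.trans (hruns₂.trans (hruns₃.trans
    (.head hstep (hruns₅.trans hruns₆))))).mono ?_⟩
  · intro b
    simp only [Control.testOutput, Bool.and_eq_true, isParity, decide_eq_true_eq, hok₂, hzero₂, hR₃]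
    rw [and_assoc]
    rfl
  · have := List.length_filter_le Sum.isLeft R₃
    rw [List.length_append, List.length_reverse, Nat.add_one_mul C.gates.length]
    omega

end Evaluation

end XorDetect

namespace XorDetect

/-! ### Enumeration of the subcubes as numbers with four digits in base `n + 1`. -/

section Odometer

variable {n : ℕ}

/-- The number with the digits `p` in base `n + 1`. -/
def rank (n : ℕ) (p : Fin 4 → ℕ) : ℕ :=
  p 0 + (n + 1) * (p 1 + (n + 1) * (p 2 + (n + 1) * p 3))

theorem rank_update (p : Fin 4 → ℕ) (r : Fin 4) (x : ℕ) :
    rank n (Function.update p r x) + p r * (n + 1) ^ (r : ℕ) =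
      rank n p + x * (n + 1) ^ (r : ℕ) := by
  fin_cases r <;> simp [rank] <;> ring

theorem rank_lt {p : Fin 4 → ℕ} (hp : ∀ r, p r ≤ n) : rank n p < (n + 1) ^ 4 := by
  have step : ∀ a x y, a ≤ n → x < y → a + (n + 1) * x < (n + 1) * y := fun a x y ha hxy =>
    calc a + (n + 1) * x < (n + 1) + (n + 1) * x := by omega
      _ = (n + 1) * (x + 1) := by ring
      _ ≤ (n + 1) * y := Nat.mul_le_mul_left _ hxy
  have := step _ _ _ (hp 0) (step _ _ _ (hp 1) (step _ _ _ (hp 2) (Nat.lt_succ_of_le (hp 3))))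
  calc rank n p < (n + 1) * ((n + 1) * ((n + 1) * (n + 1))) := this
    _ = (n + 1) ^ 4 := by ring

theorem eq_of_rank_eq {p q : Fin 4 → ℕ} (hp : ∀ r, p r ≤ n) (hq : ∀ r, q r ≤ n)
    (h : rank n p = rank n q) : p = q := by
  have step : ∀ a a' x x', a ≤ n → a' ≤ n → a + (n + 1) * x = a' + (n + 1) * x' →
      a = a' ∧ x = x' := by
    intro a a' x x' ha ha' h
    have h1 := congrArg (· % (n + 1)) h
    simp only [Nat.add_mul_mod_self_left] at h1
    rw [Nat.mod_eq_of_lt (by omega), Nat.mod_eq_of_lt (by omega)] at h1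
    subst h1
    exact ⟨rfl, Nat.eq_of_mul_eq_mul_left (Nat.succ_pos n) (Nat.add_left_cancel h)⟩
  obtain ⟨h0, h⟩ := step _ _ _ _ (hp 0) (hq 0) h
  obtain ⟨h1, h⟩ := step _ _ _ _ (hp 1) (hq 1) h
  obtain ⟨h2, h3⟩ := step _ _ _ _ (hp 2) (hq 2) h
  funext r
  fin_cases r <;> assumption

/-- The next value of the digit `r`. -/
def bump (n : ℕ) (p : Fin 4 → ℕ) (r : Fin 4) : Fin 4 → ℕ :=
  Function.update p r (if p r = n then 0 else p r + 1)

theorem bump_le {p : Fin 4 → ℕ} (hp : ∀ r, p r ≤ n) (r r' : Fin 4) : bump n p r r' ≤ n := by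
  have := hp r
  by_cases h : r' = r
  · subst h
    simp only [bump, Function.update_self]
    split <;> omega
  · simpa [bump, h] using hp r'

theorem bump_eq_iff {p : Fin 4 → ℕ} {r : Fin 4} {k : ℕ} (hk : k < n) :
    bump n p r r = k + 1 ↔ p r = k := by
  simp only [bump, Function.update_self]
  split <;> omega

/-- One pass of `shift` over the cells. -/
theorem runs_shift_pass (p : Fin 4 → ℕ) (r : Fin 4) (D : List Sym) (j : ℕ) :
    ∀ (k : ℕ) (L : List Cell) (s : Control), k + j = n → s.digit = r →
    s.zero = Function.update (fun r => decide (p r = 0)) r (decide (p r = k)) → ∃ y,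
    Runs ⟨some .shift, s, tapes [] [] [] D L
        ((List.range' k j).map fun m => .inl fun r => decide (p r = m + 1))⟩ j
      ⟨some .shift, { s with
          cell := y,
          zero := Function.update (fun r => decide (p r = 0)) r (decide (p r = n)) },
        tapes [] [] [] D (((List.range' k j).map fun m =>
          .inl fun r' => decide (bump n p r r' = m + 1)).reverse ++ L) []⟩ := by
  induction j with
  | zero =>
    intro k L s hk hr hs
    obtain rfl : k = n := hk
    refine ⟨s.cell, ?_⟩
    rw [← hs]
    exact .refl _ _
  | succ j ih =>
    intro k L s hk hr hs
    obtain ⟨y, h⟩ := ih (k + 1) (.inl (fun r' => decide (bump n p r r' = k + 1)) :: L)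
      { s with
        cell := some (.inl fun r => decide (p r = k + 1)),
        zero := Function.update (fun r => decide (p r = 0)) r (decide (p r = k + 1)) }
      (by omega) hr rfl
    rw [List.range'_succ, List.map_cons, List.map_cons, List.reverse_cons, List.append_assoc]
    refine ⟨y, .head ?_ h⟩
    -- Digit `r` is stored in one-hot form, with place 0 in the register `zero` and place `m + 1` in
    -- cell `m`. At cell `k` the register holds the old bit of place `k`, and the exchange moves it
    -- to place `k + 1`.
    have hcell : Function.update (fun r => decide (p r = k + 1)) r (decide (p r = k)) =
        fun r' => decide (bump n p r r' = k + 1) := by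
      funext r'
      by_cases h : r' = r
      · subst h
        rw [Function.update_self, decide_eq_decide, bump_eq_iff (by omega)]
      · simp [bump, h]
    simp [program, tapes, Control.exchange, Control.exchanged, Control.cellD, Cell.dirs, hr, hs,
      hcell]

/-- Moving the digit `r`. -/
theorem runs_shift (p : Fin 4 → ℕ) (D : List Sym) (s : Control)
    (hs : s.zero = fun r => decide (p r = 0)) {s' : Control} (hs' : s' = { s with
      cell := none, zero := fun r => decide (bump n p s.digit r = 0) }) :
    Runs ⟨some .shift, s, tapes [] [] [] D [] ((inputCells n p).map .inl)⟩ (n + 1)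
      (if p s.digit = n then
        if s.digit = 3 then
          ⟨some .clear, s',
            tapes [] [] [] D ((inputCells n (bump n p s.digit)).map .inl).reverse []⟩
        else
          ⟨some .restore, { s' with digit := s.digit + 1 },
            tapes [] [] [] D ((inputCells n (bump n p s.digit)).map .inl).reverse []⟩
      else
        ⟨some .back, s',
          tapes [] [] [] D ((inputCells n (bump n p s.digit)).map .inl).reverse []⟩) := by
  obtain ⟨y, h⟩ := runs_shift_pass (n := n) p s.digit D n 0 [] s (by simp) rfl (by
    rw [hs, Function.update_eq_self])
  -- The bit leaving the last cell stays in the register, so the digit `n` wraps around to 0.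
  have hz : (fun r => decide (bump n p s.digit r = 0)) =
      Function.update (fun r => decide (p r = 0)) s.digit (decide (p s.digit = n)) := by
    funext r
    by_cases hr : r = s.digit
    · subst hr
      simp only [bump, Function.update_self]
      split <;> simp [*]
    · simp [bump, hr]
  have hcells : ∀ q, (inputCells n q).map Sum.inl =
      (List.range' 0 n).map fun m => (.inl fun r => decide (q r = m + 1) : Cell) := by
    intro q
    rw [inputCells, List.map_map, List.range_eq_range']
    rfl
  rw [hcells, hcells, hs', hz]
  rw [List.append_nil] at h
  refine h.trans (.head ?_ (.refl _ 0))
  by_cases h1 : p s.digit = n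
  · by_cases h2 : s.digit = 3
    · simp [program, tapes, h2]
    · simp [program, tapes, h2]
  · simp [program, tapes, h1]

/-- Moving to the next subcube, from the digit `r` on. -/
theorem runs_next (D : List Sym) (N : ℕ) (d : ℕ) : ∀ (p : Fin 4 → ℕ) (s : Control),
    (s.digit : ℕ) + d = 3 → (∀ r, p r ≤ n) → (s.zero = fun r => decide (p r = 0)) →
    rank n p + (n + 1) ^ (s.digit : ℕ) = N + 1 →
    ∃ s', s'.ok = s.ok ∧
      ((∃ p', (∀ r, p' r ≤ n) ∧ rank n p' = N + 1 ∧ (s'.zero = fun r => decide (p' r = 0)) ∧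
        Runs ⟨some .shift, s, tapes [] [] [] D [] ((inputCells n p).map .inl)⟩
          ((d + 1) * (2 * n + 2))
          ⟨some .back, s', tapes [] [] [] D ((inputCells n p').map .inl).reverse []⟩) ∨
      ((n + 1) ^ 4 ≤ N + 1 ∧ ∃ L, L.length = n ∧
        Runs ⟨some .shift, s, tapes [] [] [] D [] ((inputCells n p).map .inl)⟩
          ((d + 1) * (2 * n + 2)) ⟨some .clear, s', tapes [] [] [] D L []⟩)) := by
  -- Invariant: adding `(n + 1) ^ s.digit` to the current rank gives the rank looked for, `N + 1`. A
  -- digit that wraps around loses `n * (n + 1) ^ s.digit`, which is made up for by the carry to the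
  -- next digit; `d` digits lie above the current one.
  induction d with
  | zero =>
    intro p s hd hp hs hN
    have hrun := runs_shift (n := n) p D s hs rfl
    have hrank := rank_update (n := n) p s.digit (if p s.digit = n then 0 else p s.digit + 1)
    have hdigit : s.digit = 3 := Fin.ext (by omega)
    by_cases hn : p s.digit = n
    · rw [if_pos hn, if_pos hdigit] at hrun
      refine ⟨{ s with cell := none, zero := fun r => decide (bump n p s.digit r = 0) }, rfl,
        .inr ⟨?_, _, ?_, hrun.mono ?_⟩⟩
      · have hexp : (s.digit : ℕ) = 3 := hd
        rw [if_pos hn, hn, hexp] at hrank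
        rw [hexp] at hN
        -- A carry out of the top digit: `N + 1` has reached the number of all subcubes.
        have : (n + 1) ^ 4 = n * (n + 1) ^ 3 + (n + 1) ^ 3 := by ring
        omega
      · simp [inputCells]
      · omega
    · rw [if_neg hn] at hrun
      rw [if_neg hn, Nat.add_one_mul (p s.digit)] at hrank
      refine ⟨{ s with cell := none, zero := fun r => decide (bump n p s.digit r = 0) }, rfl,
        .inl ⟨bump n p s.digit, bump_le hp _, ?_, rfl, hrun.mono ?_⟩⟩
      · rw [bump, if_neg hn]
        omega
      · omega
  | succ d ih =>
    intro p s hd hp hs hN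
    have hrun := runs_shift (n := n) p D s hs rfl
    have hrank := rank_update (n := n) p s.digit (if p s.digit = n then 0 else p s.digit + 1)
    have hdigit : s.digit ≠ 3 := fun h => by
      have h3 : (s.digit : ℕ) = 3 := congrArg Fin.val h
      omega
    by_cases hn : p s.digit = n
    · rw [if_pos hn, if_neg hdigit] at hrun
      rw [if_pos hn, hn] at hrank
      have hsucc : ((s.digit + 1 : Fin 4) : ℕ) = s.digit + 1 := by
        rw [Fin.val_add_one, if_neg (show s.digit ≠ Fin.last 3 from hdigit)]
      have hrestore := runs_restore ((inputCells n (bump n p s.digit)).map .inl).reverse [] D []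
        { s with
          cell := none
          zero := fun r => decide (bump n p s.digit r = 0)
          digit := s.digit + 1 }
      have hfilter : ((((inputCells n (bump n p s.digit)).map .inl).reverse.filter
          Sum.isLeft).reverse ++ [] : List Cell) = (inputCells n (bump n p s.digit)).map .inl := by
        rw [List.filter_eq_self.2]
        · simp
        · simp
      rw [hfilter] at hrestore
      obtain ⟨s', hok, h⟩ := ih (bump n p s.digit)
        { s with
          cell := none
          zero := fun r => decide (bump n p s.digit r = 0)
          digit := s.digit + 1 } (by simp only [hsucc]; omega) (bump_le hp _) rfl (by
            simp only [hsucc]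
            rw [← hN, bump, if_pos hn, pow_succ, Nat.mul_add_one, mul_comm _ n]
            omega)
      have hlen : (((inputCells n (bump n p s.digit)).map .inl).reverse : List Cell).length = n := by
        simp [inputCells]
      rw [hlen] at hrestore
      have htime : n + 1 + (n + 1 + (d + 1) * (2 * n + 2)) ≤ (d + 1 + 1) * (2 * n + 2) := by
        rw [Nat.add_one_mul (d + 1)]
        omega
      refine ⟨s', hok, h.imp ?_ ?_⟩
      · rintro ⟨p', hp', hr', hz', h⟩
        exact ⟨p', hp', hr', hz', (hrun.trans (hrestore.trans h)).mono htime⟩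
      · rintro ⟨hle, L, hL, h⟩
        exact ⟨hle, L, hL, (hrun.trans (hrestore.trans h)).mono htime⟩
    · rw [if_neg hn] at hrun
      rw [if_neg hn, Nat.add_one_mul (p s.digit)] at hrank
      refine ⟨{ s with cell := none, zero := fun r => decide (bump n p s.digit r = 0) }, rfl,
        .inl ⟨bump n p s.digit, bump_le hp _, ?_, rfl, hrun.mono ?_⟩⟩
      · rw [bump, if_neg hn]
        omega
      · rw [Nat.add_one_mul (d + 1)]
        omega

/-- The number of steps for one subcube. -/
def Circuit.roundTime (C : Circuit n) : ℕ :=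
  (C.gates.length + 1) * (7 * (n + C.gates.length) + 12) + 4 * (2 * n + 2) + (C.body.length + 1)

/-- The tests for all subcubes. -/
theorem runs_subcubes (C : Circuit n) (M : ℕ) : ∀ (p : Fin 4 → ℕ) (s : Control) (L R : List Cell),
    (∀ r, p r ≤ n) → (n + 1) ^ 4 ≤ rank n p + M → L.reverse ++ R = (inputCells n p).map .inl →
    s.cur = .tick → (s.zero = fun r => decide (p r = 0)) →
    ∃ s' L', L'.length = n ∧
      (∀ b, s'.ok b = true ↔ s.ok b = true ∧
        ∀ q : Fin 4 → ℕ, (∀ r, q r ≤ n) → rank n p ≤ rank n q → C.Passes b q) ∧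
      Runs ⟨some .token, s, tapes [] [] C.body [] L R⟩ (M * C.roundTime)
        ⟨some .clear, s', tapes [] [] [] C.body.reverse L' []⟩ := by
  -- `M` bounds the number of subcubes still to be tested; it cannot be 0, because all ranks are
  -- below `(n + 1) ^ 4`.
  induction M with
  | zero =>
    intro p s L R hp hM
    exact absurd (rank_lt hp) (not_lt.2 hM)
  | succ M ih =>
    intro p s L R hp hM hcells hcur hzero
    obtain ⟨s₁, hdigit₁, hzero₁, hok₁, hruns₁⟩ := runs_subcube C p hcells hcur hzero
    obtain ⟨s₂, hok₂, h⟩ := runs_next C.body.reverse (rank n p) 3 p s₁ (by rw [hdigit₁]; rfl) hp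
      hzero₁ (by rw [hdigit₁]; rfl)
    rcases h with ⟨p', hp', hrank, hzero₂, hruns₂⟩ | ⟨hlast, L', hL', hruns₂⟩
    · have hruns₃ := runs_back C.body.reverse ((inputCells n p').map .inl).reverse [] [] s₂
      rw [List.reverse_reverse, List.append_nil] at hruns₃
      obtain ⟨s₄, L', hL', hok₄, hruns₄⟩ := ih p' { s₂ with sym := none, cur := .tick }
        ((inputCells n p').map .inl).reverse [] hp' (by omega) (by simp) rfl hzero₂
      refine ⟨s₄, L', hL', fun b => ?_, (hruns₁.trans (hruns₂.trans (hruns₃.trans hruns₄))).mono ?_⟩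
      · rw [hok₄, hok₂, hok₁, and_assoc, hrank]
        refine and_congr_right fun _ => ⟨fun h q hq hle => ?_, fun h => ⟨h p hp le_rfl,
          fun q hq hle => h q hq (by omega)⟩⟩
        rcases Nat.eq_or_lt_of_le hle with heq | hlt
        · rw [← eq_of_rank_eq hp hq heq]
          exact h.1
        · exact h.2 q hq hlt
      · rw [Nat.add_one_mul M, List.length_reverse]
        simp only [Circuit.roundTime]
        omega
    · refine ⟨s₂, L', hL', fun b => ?_, (hruns₁.trans hruns₂).mono ?_⟩
      · rw [hok₂, hok₁]
        refine and_congr_right fun _ => ⟨fun h q hq hle => ?_, fun h => h p hp le_rfl⟩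
        have := rank_lt hq
        rwa [← eq_of_rank_eq hp hq (by omega)]
      · rw [Nat.add_one_mul M]
        simp only [Circuit.roundTime]
        omega

end Odometer

end XorDetect

namespace XorDetect

/-! ### Running time and the whole computation. -/

section Time

variable {n : ℕ}

theorem Gate.length_reads_le (g : Gate n) : g.reads.length ≤ 2 := by
  cases g <;> simp [reads]

/-- In a normalized circuit, every gate that is not binary is the output or is read by a binary
gate. -/
theorem Circuit.Normalized.read_of_not_isBinary {C : Circuit n} (hC : C.Normalized) {k : ℕ}
    {g : Gate n} (hg : C.gates[k]? = some g) (hb : g.isBinary = false) :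
    C.output = .gate k ∨ ∃ h ∈ C.gates.filter Gate.isBinary, Wire.gate k ∈ h.reads := by
  -- In a normalized circuit a negation reads neither a constant nor a negation, so the reader must
  -- be binary.
  refine (hC.free_used k g hg hb).imp_right fun ⟨h, hh, hk⟩ => ⟨h, ?_, hk⟩
  cases h with
  | const b => simp [Gate.reads] at hk
  | neg a =>
    obtain rfl : Wire.gate k = a := by simpa [Gate.reads] using hk
    cases g with
    | const b => exact absurd hg (hC.no_const_read _ hh k hk b)
    | neg a => exact absurd hg (hC.no_double_neg k hh a)
    | conj a b => simp [Gate.isBinary] at hb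
    | disj a b => simp [Gate.isBinary] at hb
  | conj a b => exact List.mem_filter.2 ⟨hh, rfl⟩
  | disj a b => exact List.mem_filter.2 ⟨hh, rfl⟩

/-- The number of gates of a normalized circuit is bounded in terms of its size. -/
theorem Circuit.Normalized.length_gates_le {C : Circuit n} (hC : C.Normalized) :
    C.gates.length ≤ 3 * C.size + 1 := by
  -- Every gate that is not binary occurs among the output and the wires read by binary gates, so
  -- there are at most `2 * C.size + 1` of them.
  let W : List (Wire n) := C.output :: (C.gates.filter Gate.isBinary).flatMap Gate.reads
  have hW : W.length ≤ 2 * C.size + 1 := by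
    rw [List.length_cons, List.length_flatMap, Circuit.size, List.countP_eq_length_filter]
    have := List.sum_le_card_nsmul ((C.gates.filter Gate.isBinary).map fun g => g.reads.length) 2
      (by
        intro x hx
        obtain ⟨g, -, rfl⟩ := List.mem_map.1 hx
        exact g.length_reads_le)
    rw [List.length_map, smul_eq_mul] at this
    omega
  have hsub : (Finset.range C.gates.length).image (Wire.gate (n := n)) ⊆
      C.binaries.image Wire.gate ∪ W.toFinset := by
    intro w hw
    obtain ⟨k, hk, rfl⟩ := Finset.mem_image.1 hw
    have hk' := Finset.mem_range.1 hk
    have hg := List.getElem?_eq_getElem hk'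
    rw [Finset.mem_union, List.mem_toFinset]
    cases hb : C.gates[k].isBinary with
    | true => exact .inl (Finset.mem_image_of_mem _ (C.mem_binaries.2 ⟨_, hg, hb⟩))
    | false =>
      right
      rcases hC.read_of_not_isBinary hg hb with h | ⟨h, hh, hk⟩
      · rw [← h]
        exact List.mem_cons_self
      · exact List.mem_cons_of_mem _ (List.mem_flatMap.2 ⟨h, hh, hk⟩)
  have hcard := Finset.card_le_card hsub
  rw [Finset.card_image_of_injective _ (fun _ _ h => Wire.gate.inj h), Finset.card_range] at hcard
  have h1 := Finset.card_union_le (C.binaries.image (Wire.gate (n := n))) W.toFinset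
  have h2 : (C.binaries.image (Wire.gate (n := n))).card ≤ C.size :=
    Finset.card_image_le.trans C.card_binaries.le
  have h3 := W.toFinset_card_le
  omega

theorem Wire.length_encode_le {w : Wire n} {k : ℕ} (hw : w.Before k) :
    w.encode.length ≤ n + k + 1 := by
  cases w with
  | input i =>
    simp only [encode, List.length_cons, List.length_replicate]
    omega
  | gate j =>
    have : j < k := hw
    simp only [encode, List.length_cons, List.length_replicate]
    omega

theorem Circuit.length_body_le (C : Circuit n) :
    C.body.length ≤ (C.gates.length + 1) * (2 * (n + C.gates.length) + 3) := by
  have hgate : ∀ g ∈ C.gates, g.encode.length ≤ 2 * (n + C.gates.length) + 3 := by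
    intro g hg
    obtain ⟨k, hk, rfl⟩ := List.getElem_of_mem hg
    have hwire : ∀ w ∈ C.gates[k].reads, w.encode.length ≤ n + C.gates.length + 1 := fun w hw =>
      Wire.length_encode_le (.mono hk.le (C.acyclic k _ (List.getElem?_eq_getElem hk) w hw))
    revert hwire
    cases C.gates[k] <;> simp [Gate.encode, Gate.reads] <;> omega
  have hsum := List.sum_le_card_nsmul (C.gates.map fun g => g.encode.length)
    (2 * (n + C.gates.length) + 3) (by
      intro x hx
      obtain ⟨g, hg, rfl⟩ := List.mem_map.1 hx
      exact hgate g hg)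
  have hout := Wire.length_encode_le C.output_valid
  rw [List.length_map, smul_eq_mul] at hsum
  rw [Circuit.body, List.length_append, List.length_flatMap, List.length_cons,
    Nat.add_one_mul C.gates.length]
  omega

/-- This is what delimits the unary number of variables in the description. -/
theorem Circuit.exists_body_eq (C : Circuit n) : ∃ t rest, t ≠ Sym.tick ∧ C.body = t :: rest := by
  rw [Circuit.body]
  cases C.gates with
  | nil => exact ⟨.output, _, by simp, rfl⟩
  | cons g gs => cases g <;> exact ⟨_, _, by simp, rfl⟩

/-- The blank cells created at the start represent the first subcube, all of whose directions are
zero. -/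
theorem inputCells_zero : (inputCells n fun _ => 0) = List.replicate n fun _ => false := by
  rw [inputCells, List.eq_replicate_iff]
  refine ⟨by simp, fun c hc => ?_⟩
  obtain ⟨m, -, rfl⟩ := List.mem_map.1 hc
  simp

/-- The whole computation. -/
theorem runs_machine (C : Circuit n) (hn : 1 ≤ n) (hsize : C.size = 3 * (n - 1)) :
    Runs ⟨some .cells, Control.init, tapes C.encode [] [] [] [] []⟩
      ((n + 1) ^ 4 * C.roundTime + (2 * n + 3 * C.body.length + 3))
      ⟨none, Control.init, tapes [] [C.verdict] [] [] [] []⟩ := by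
  obtain ⟨t, rest, ht, hbody⟩ := C.exists_body_eq
  have hencode : C.encode = List.replicate n .tick ++ t :: rest := by
    rw [← hbody, Circuit.encode, Circuit.body, List.append_assoc]
  have h₁ := runs_cells n t ht rest [] [] [] [] Control.init
  have h₂ := runs_load rest [] (List.replicate n (.inl fun _ => false) ++ []) [] [t]
    { Control.init with sym := some t }
  have h₃ := runs_back (rest.reverse ++ [t]) (List.replicate n (.inl fun _ => false) ++ []) [] []
    { Control.init with sym := none }
  obtain ⟨s, L, hL, hok, h₄⟩ := runs_subcubes C ((n + 1) ^ 4) (fun _ => 0)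
    { Control.init with sym := none, cur := .tick } (List.replicate n (.inl fun _ => false) ++ []) []
    (by simp) (Nat.le_add_left _ _) (by simp [inputCells_zero]) rfl (by simp [Control.init])
  have h₅ := runs_clear (n + C.body.length) C.body.reverse L s (by simp) (by omega)
  have hverdict : s.verdict = C.verdict := by
    have hpass : ∀ b, s.ok b = true ↔ ∀ q : Fin 4 → ℕ, (∀ r, q r ≤ n) → C.Passes b q := by
      intro b
      rw [hok]
      simp [Control.init, rank]
    rw [C.verdict_eq hn hsize]
    classical exact if_congr (hpass _) rfl (if_congr (hpass _) rfl rfl)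
  rw [← hencode] at h₁
  have htodo : (rest.reverse ++ [t]).reverse ++ [] = C.body := by
    rw [hbody]
    simp
  rw [htodo] at h₃
  rw [hverdict] at h₅
  refine (h₁.trans (h₂.trans (h₃.trans (h₄.trans h₅)))).mono ?_
  have hlen : C.body.length = rest.length + 1 := by rw [hbody, List.length_cons]
  rw [List.length_append, List.length_reverse, List.length_singleton]
  omega

theorem haltsWithin_of_runs {u : List Sym} {v : Verdict} {t : ℕ}
    (h : Runs ⟨some .cells, Control.init, tapes u [] [] [] [] []⟩ t
      ⟨none, Control.init, tapes [] [v] [] [] [] []⟩) : HaltsWithin machine u [v] t := by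
  have hinit : Turing.initList machine.tm (u.map machine.inputAlphabet.symm) =
      ⟨some .cells, Control.init, tapes u [] [] [] [] []⟩ := by
    have hu : u.map machine.inputAlphabet.symm = u := List.map_id u
    rw [hu]
    refine congrArg (Turing.TM2.Cfg.mk _ _) (funext fun k => ?_)
    cases k <;> rfl
  have hhalt : Turing.haltList machine.tm ([v].map machine.outputAlphabet.symm) =
      ⟨none, Control.init, tapes [] [v] [] [] [] []⟩ := by
    refine congrArg (Turing.TM2.Cfg.mk _ _) (funext fun k => ?_)
    cases k <;> rfl
  rw [HaltsWithin, Turing.TM2OutputsInTime, hinit, Option.map_some, hhalt]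
  exact h.evalsToInTime

/-- Normalization makes the number of gates linear in `n`; hence the description and a round are
quadratic, and there are at most `(n + 1) ^ 4` rounds. The constants are generous. -/
theorem Circuit.time_le (C : Circuit n) (hn : 1 ≤ n) (hC : C.Normalized)
    (hsize : C.size = 3 * (n - 1)) :
    (n + 1) ^ 4 * C.roundTime + (2 * n + 3 * C.body.length + 3) ≤ 3000 * (n + 1) ^ 6 := by
  have hgates : C.gates.length + 1 ≤ 9 * (n + 1) := by
    have := hC.length_gates_le
    omega
  have hbody : C.body.length ≤ 180 * (n + 1) ^ 2 := by
    calc C.body.length ≤ (C.gates.length + 1) * (2 * (n + C.gates.length) + 3) := C.length_body_le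
      _ ≤ (9 * (n + 1)) * (20 * (n + 1)) := Nat.mul_le_mul hgates (by omega)
      _ = 180 * (n + 1) ^ 2 := by ring
  have hfirst : (C.gates.length + 1) * (7 * (n + C.gates.length) + 12) ≤ 738 * (n + 1) ^ 2 := by
    calc _ ≤ (9 * (n + 1)) * (82 * (n + 1)) := Nat.mul_le_mul hgates (by omega)
      _ = 738 * (n + 1) ^ 2 := by ring
  have hlin : n + 1 ≤ (n + 1) ^ 2 := Nat.le_self_pow two_ne_zero _
  have hround : C.roundTime ≤ 1000 * (n + 1) ^ 2 := by
    rw [Circuit.roundTime]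
    omega
  have hpow : (n + 1) ^ 2 ≤ (n + 1) ^ 6 := Nat.pow_le_pow_right n.succ_pos (by norm_num)
  calc (n + 1) ^ 4 * C.roundTime + (2 * n + 3 * C.body.length + 3)
      ≤ (n + 1) ^ 4 * (1000 * (n + 1) ^ 2) + 600 * (n + 1) ^ 2 :=
        Nat.add_le_add (Nat.mul_le_mul_left _ hround) (by omega)
    _ = 1000 * (n + 1) ^ 6 + 600 * (n + 1) ^ 2 := by ring
    _ ≤ 3000 * (n + 1) ^ 6 := by omega

end Time

end XorDetect

/-- One Turing machine decides, for every normalized DeMorgan circuit on `n ≥ 1` variables of size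
`3 (n - 1)`, whether it computes the parity function, its negation, or neither, in a number of
steps that is polynomial in `n`. -/
theorem mainTheorem8 :
    ∃ (M : Turing.TM2ComputableAux XorDetect.Sym XorDetect.Verdict) (p : Polynomial ℕ),
      ∀ (n : ℕ), 1 ≤ n → ∀ C : XorDetect.Circuit n, C.Normalized → C.size = 3 * (n - 1) →
        XorDetect.HaltsWithin M C.encode [C.verdict] (p.eval n) := by
  refine ⟨XorDetect.machine, 3000 * (Polynomial.X + 1) ^ 6, fun n hn C hC hsize => ?_⟩
  refine XorDetect.haltsWithin_of_runs ((XorDetect.runs_machine C hn hsize).mono ?_)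
  simpa using C.time_le hn hC hsize
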